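/- Let $n\ge 1$, let $D\subset\mathbb{C}^n$ be a bounded pseudoconvex domain, $\omega=i\partial\bar\partial|z|^2=i\sum_j dz_j\wedge d\bar z_j$ the standard Kähler metric, $dV_\omega=\omega^n/n!$, and $\Lambda_\omega$ the adjoint of $\omega\wedge\cdot$. Let $E\to D$ be a holomorphic vector bundle of finite rank, $h$ a smooth Hermitian metric on $E$, and $i\Theta_{(E,h)}=i\sum_{j,k}\Theta_{j\bar k}\,dz_j\wedge d\bar z_k$ its Chern curvature, $\Theta_{j\bar k}\in\mathrm{End}(E)$. Let $c\ge 0$ be a constant. Suppose that for every smooth strictly plurisubharmonic function $\psi$ on $D$ and every smooth $E$-valued $(n,n)$-form $f$ on $D$ with compact support there is an $E$-valued $(n,n-1)$-form $u$ on $D$, with locally integrable coefficients, such that $\bar\partial u=f$ in the sense of distributions and $$\int_D|u|^2_{(\omega,h)}e^{-\psi}\,dV_\omega\le\int_D\big\langle([i\partial\bar\partial\psi\otimes \mathrm{Id}_E,\Lambda_\omega]+c)^{-1}f,f\big\rangle_{(\omega,h)}e^{-\psi}\,dV_\omega ,$$ where the integral on the left is finite and the inverse is that of the operator acting on $E$-valued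 $(n,n)$-forms. Then $$\mathrm{tr}_\omega(i\Theta_{(E,h)}a,a)_h=\sum_{j=1}^n(\Theta_{j\bar j}a,a)_h\ \ge\ c\,|a|_h^2\qquad\text{for all }x\in D,\ a\in E_x .$$ In particular, if $c>0$ then $(E,h)$ is RC-positive: for every $x\in D$ and every nonzero $a\in E_x$ there is $v\in T_xD\cong\mathbb{C}^n$ with $(i\Theta_{(E,h)}(v,v)a,a)_h:=\sum_{j,k}(\Theta_{j\bar k}a,a)_h\,v_j\bar v_k>0$. If $c=0$ then $(E,h)$ is RC-semipositive: for every $x\in D$ and every nonzero $a\in E_x$ there is a nonzero $v\in T_xD$ with $(i\Theta_{(E,h)}(v,v)a,a)_h\ge 0$. -/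

import Mathlib

open scoped Manifold ContDiff ComplexConjugate ComplexOrder
open MeasureTheory Bundle

noncomputable section

namespace RCPos

/-! ### Calculus on open subsets of complex Euclidean space -/

/-- The space `ℂⁿ` with its Euclidean norm. -/
abbrev Cn (n : ℕ) : Type := EuclideanSpace ℂ (Fin n)

/-- The Wirtinger derivative `∂g/∂z_j = (∂g/∂x_j - i ∂g/∂y_j)/2`. -/
def dDeriv {n : ℕ} {W : Type*} [NormedAddCommGroup W] [NormedSpace ℂ W]
    (j : Fin n) (g : Cn n → W) (z : Cn n) : W :=
  (1 / 2 : ℂ) • (fderiv ℝ g z (EuclideanSpace.single j 1)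
    - Complex.I • fderiv ℝ g z (EuclideanSpace.single j Complex.I))

/-- The Wirtinger derivative `∂g/∂z̄_k = (∂g/∂x_k + i ∂g/∂y_k)/2`. -/
def dbarDeriv {n : ℕ} {W : Type*} [NormedAddCommGroup W] [NormedSpace ℂ W]
    (k : Fin n) (g : Cn n → W) (z : Cn n) : W :=
  (1 / 2 : ℂ) • (fderiv ℝ g z (EuclideanSpace.single k 1)
    + Complex.I • fderiv ℝ g z (EuclideanSpace.single k Complex.I))

/-- The complex Hessian `(∂²ψ/∂z_j∂z̄_k)_{jk}`, i.e. the coefficients of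
`i∂∂̄ψ = ∑ ψ_{jk} i dz_j ∧ dz̄_k`. -/
def levi {n : ℕ} (ψ : Cn n → ℝ) (z : Cn n) : Matrix (Fin n) (Fin n) ℂ :=
  Matrix.of fun j k => dDeriv j (fun w => dbarDeriv k (fun y => (ψ y : ℂ)) w) z

/-- `ψ` is smooth and strictly plurisubharmonic on the open set `D`
(values of `ψ` outside `D` play no role). -/
def IsSmoothStrictlyPsh {n : ℕ} (D : TopologicalSpace.Opens (Cn n)) (ψ : Cn n → ℝ) : Prop :=
  ContDiffOn ℝ ∞ ψ D ∧ ∀ z ∈ D, (levi ψ z).PosDef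

/-- `D` is pseudoconvex: it has a smooth plurisubharmonic exhaustion function. -/
def IsPseudoconvex {n : ℕ} (D : TopologicalSpace.Opens (Cn n)) : Prop :=
  ∃ ρ : Cn n → ℝ, ContDiffOn ℝ ∞ ρ D ∧ (∀ z ∈ D, (levi ρ z).PosSemidef) ∧
    ∀ t : ℝ, IsCompact {z : Cn n | z ∈ D ∧ ρ z ≤ t}

/-- Extension by zero of a function on `D` to `ℂⁿ`. It is only ever differentiated at points of
the open set `D`. -/
def zeroExt {n : ℕ} {D : TopologicalSpace.Opens (Cn n)} {W : Type*} [Zero W]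
    (g : D → W) : Cn n → W :=
  Function.extend Subtype.val g 0

/-- `g : D → W` is (real) `C^∞` on the subset `U` of `D` (used for open `U`). -/
def SmoothOn {n : ℕ} {D : TopologicalSpace.Opens (Cn n)} {W : Type*} [NormedAddCommGroup W]
    [NormedSpace ℂ W] (g : D → W) (U : Set D) : Prop :=
  ContDiffOn ℝ ∞ (zeroExt g) (Subtype.val '' U)

/-- The volume form `dV_ω = ωⁿ/n!` of `ω = i∂∂̄|z|² = i ∑ dz_j ∧ dz̄_j` on `D`; since
`i dz ∧ dz̄ = 2 dx ∧ dy`, it is `2ⁿ` times Lebesgue measure. -/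
def dVol {n : ℕ} (D : TopologicalSpace.Opens (Cn n)) : Measure D :=
  (2 ^ n : ENNReal) • Measure.comap (Subtype.val : D → Cn n) volume

/-! ### The exterior algebra of `(p,q)`-forms at a point -/

/-- Labels of the covectors `dz_1 < ⋯ < dz_n < dz̄_1 < ⋯ < dz̄_n`. -/
abbrev Cov (n : ℕ) : Type := Fin n ⊕ₗ Fin n

/-- The label of `dz_j`. -/
abbrev dz {n : ℕ} (j : Fin n) : Cov n := Sum.inlₗ j

/-- The label of `dz̄_k`. -/
abbrev dzbar {n : ℕ} (k : Fin n) : Cov n := Sum.inrₗ k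

/-- The sets `S = J ∪ K` of labels with `p` elements of type `dz` and `q` of type `dz̄`; they label
the basis `dz_J ∧ dz̄_K` (factors in increasing order) of the space of `(p,q)`-covectors. -/
abbrev Idx (n p q : ℕ) : Type :=
  {S : Finset (Cov n) //
    (Finset.univ.filter fun j : Fin n => dz j ∈ S).card = p ∧
    (Finset.univ.filter fun k : Fin n => dzbar k ∈ S).card = q}

/-- `V`-valued `(p,q)`-covectors, `Λ^{p,q} ⊗ V`, by their coefficients in the basis
`dz_J ∧ dz̄_K`. -/
abbrev Form (n p q : ℕ) (V : Type*) : Type _ := Idx n p q → V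

/-- The matrix of left exterior multiplication `a ∧ ·` by a basic covector `a`, on the basis
`dz_J ∧ dz̄_K` of the full exterior algebra:
`a ∧ e_T = (-1)^{#{b ∈ T, b < a}} e_{T ∪ {a}}` if `a ∉ T`, and `0` otherwise. -/
def ext {n : ℕ} (a : Cov n) : Matrix (Finset (Cov n)) (Finset (Cov n)) ℂ :=
  Matrix.of fun S T =>
    if a ∉ T ∧ S = insert a T then (-1) ^ (T.filter fun b => b < a).card else 0

/-- The matrix of exterior multiplication by the `(1,1)`-form `∑ A_{jk} i dz_j ∧ dz̄_k`. -/
def wedge11 {n : ℕ} (A : Matrix (Fin n) (Fin n) ℂ) :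
    Matrix (Finset (Cov n)) (Finset (Cov n)) ℂ :=
  ∑ j, ∑ k, (Complex.I * A j k) • (ext (dz j) * ext (dzbar k))

/-- `L_ω = ω ∧ ·` for `ω = i ∑ dz_j ∧ dz̄_j`. -/
def Lom (n : ℕ) : Matrix (Finset (Cov n)) (Finset (Cov n)) ℂ := wedge11 1

/-- `Λ_ω`, the adjoint of `L_ω` (the basis `dz_J ∧ dz̄_K` is orthonormal with respect to `ω`). -/
def Lam (n : ℕ) : Matrix (Finset (Cov n)) (Finset (Cov n)) ℂ := (Lom n).conjTranspose

/-- The operator `[i∂∂̄ψ, Λ_ω] + c` at the point `z`. -/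
def twistedOp {n : ℕ} (ψ : Cn n → ℝ) (c : ℝ) (z : Cn n) :
    Matrix (Finset (Cov n)) (Finset (Cov n)) ℂ :=
  wedge11 (levi ψ z) * Lam n - Lam n * wedge11 (levi ψ z) + (c : ℂ) • 1

/-- The inverse of `[i∂∂̄ψ, Λ_ω] + c` as an operator on `(p,q)`-covectors (the commutator has
bidegree `(0,0)`, so its restriction to `(p,q)`-covectors is the corresponding diagonal block). -/
def twistedOpInv {n : ℕ} (p q : ℕ) (ψ : Cn n → ℝ) (c : ℝ) (z : Cn n) :
    Matrix (Idx n p q) (Idx n p q) ℂ :=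
  ((twistedOp ψ c z).submatrix Subtype.val Subtype.val)⁻¹

/-- The operator `M ⊗ Id_V` on `V`-valued covectors, where `M` acts on scalar ones. -/
def tensorId {I J : Type*} [Fintype J] {V : Type*} [AddCommGroup V] [Module ℂ V]
    (M : Matrix I J ℂ) (f : J → V) : I → V :=
  fun S => ∑ T, M S T • f T

/-! ### Holomorphic vector bundles of rank `r` over `D`, with a Hermitian metric -/

section Bundle

variable {n r : ℕ} {D : TopologicalSpace.Opens (Cn n)} {E : D → Type*}
  [∀ x, AddCommGroup (E x)] [∀ x, Module ℂ (E x)] [∀ x, TopologicalSpace (E x)]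
  [TopologicalSpace (TotalSpace (Fin r → ℂ) E)] [FiberBundle (Fin r → ℂ) E]
  [VectorBundle ℂ (Fin r → ℂ) E]

/-- `s` is a smooth section of `E`: its components in every holomorphic frame of the bundle atlas
are smooth. -/
def IsSmoothSection (r : ℕ) {E : D → Type*} [∀ x, AddCommGroup (E x)] [∀ x, Module ℂ (E x)]
    [∀ x, TopologicalSpace (E x)] [TopologicalSpace (TotalSpace (Fin r → ℂ) E)]
    [FiberBundle (Fin r → ℂ) E] [VectorBundle ℂ (Fin r → ℂ) E] (s : ∀ x, E x) : Prop :=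
  ∀ (e : Trivialization (Fin r → ℂ) (π (Fin r → ℂ) E)) [MemTrivializationAtlas e],
    SmoothOn (fun x => e.linearMapAt ℂ x (s x)) e.baseSet

/-- A smooth Hermitian metric on `E`; `inner x` is linear in the first variable and conjugate linear
in the second one, and `inner x v v = |v|²_h`. -/
structure HermitianMetric (r : ℕ) {n : ℕ} {D : TopologicalSpace.Opens (Cn n)} (E : D → Type*)
    [∀ x, AddCommGroup (E x)] [∀ x, Module ℂ (E x)] [∀ x, TopologicalSpace (E x)]
    [TopologicalSpace (TotalSpace (Fin r → ℂ) E)] [FiberBundle (Fin r → ℂ) E]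
    [VectorBundle ℂ (Fin r → ℂ) E] where
  /-- The Hermitian inner product on the fibre over `x`. -/
  inner : ∀ x, E x →ₗ[ℂ] E x →ₗ⋆[ℂ] ℂ
  conj_symm : ∀ x v w, inner x w v = conj (inner x v w)
  pos : ∀ x v, v ≠ 0 → 0 < (inner x v v).re
  smooth : ∀ (e : Trivialization (Fin r → ℂ) (π (Fin r → ℂ) E)) [MemTrivializationAtlas e]
    (v w : Fin r → ℂ),
    SmoothOn (fun x => inner x (e.symm x v) (e.symm x w)) e.baseSet

namespace HermitianMetric

variable (h : HermitianMetric r E)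

/-- The pointwise inner product `⟨f, g⟩_{(ω,h)}` of `E_x`-valued `(p,q)`-covectors
(the basis `dz_J ∧ dz̄_K` is orthonormal with respect to `ω`). -/
def formInner {p q : ℕ} (x : D) (f g : Form n p q (E x)) : ℂ :=
  ∑ S, h.inner x (f S) (g S)

/-- The Gram matrix `H_{αβ} = (e_α, e_β)_h` of the holomorphic frame `e_1, …, e_r` given by a
local trivialization `e`. -/
def gram (e : Trivialization (Fin r → ℂ) (π (Fin r → ℂ) E)) (z : Cn n) :
    Matrix (Fin r) (Fin r) ℂ :=
  Matrix.of fun α β =>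
    zeroExt (fun x : D => h.inner x (e.symm x (Pi.single α 1)) (e.symm x (Pi.single β 1))) z

/-- The coefficient `A_j` of the connection form `∑ A_j dz_j` of the Chern connection in the
holomorphic frame given by `e`; it is determined by `∂_j H(v,w) = H(A_j v, w)` for constant `v, w`,
i.e. `A_jᵀ H = ∂_j H`. -/
def connCoeff (e : Trivialization (Fin r → ℂ) (π (Fin r → ℂ) E)) (j : Fin n) (z : Cn n) :
    Matrix (Fin r) (Fin r) ℂ :=
  ((Matrix.of fun α β => dDeriv j (fun w => h.gram e w α β) z) * (h.gram e z)⁻¹).transpose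

/-- The coefficients `Θ_{jk} = -∂A_j/∂z̄_k` of the Chern curvature
`Θ = ∂̄(∑ A_j dz_j) = ∑ Θ_{jk} dz_j ∧ dz̄_k` in the holomorphic frame given by `e`. -/
def curvCoeff (e : Trivialization (Fin r → ℂ) (π (Fin r → ℂ) E)) (j k : Fin n) (z : Cn n) :
    Matrix (Fin r) (Fin r) ℂ :=
  Matrix.of fun α β => - dbarDeriv k (fun w => h.connCoeff e j w α β) z

/-- The coefficients `Θ_{jk} ∈ End(E_x)` of the Chern curvature `Θ = ∑ Θ_{jk} dz_j ∧ dz̄_k` of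
`(E, h)`, i.e. `iΘ = ∑ Θ_{jk} i dz_j ∧ dz̄_k`; they do not depend on the holomorphic frame. -/
def chernCurvature (x : D) (j k : Fin n) : E x →ₗ[ℂ] E x :=
  let e := trivializationAt (Fin r → ℂ) E x
  e.symmₗ ℂ x ∘ₗ Matrix.toLin' (h.curvCoeff e j k x) ∘ₗ e.linearMapAt ℂ x

/-- The `(1,1)`-form `(iΘ a, a)_h = ∑ (Θ_{jk} a, a)_h i dz_j ∧ dz̄_k` at `x`, by its coefficients. -/
def curvForm (x : D) (a : E x) : Matrix (Fin n) (Fin n) ℂ :=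
  Matrix.of fun j k => h.inner x (h.chernCurvature x j k a) a

/-- `(iΘ(v,v) a, a)_h = ∑ (Θ_{jk} a, a)_h v_j v̄_k` for a tangent vector `v = ∑ v_j ∂/∂z_j`. -/
def curvEval (x : D) (v : Cn n) (a : E x) : ℝ :=
  (∑ j, ∑ k, h.curvForm x a j k * v j * conj (v k)).re

/-- `tr_ω (iΘ a, a)_h`; the trace is taken with respect to `ω = ∑ i dz_j ∧ dz̄_j`. -/
def trCurv (x : D) (a : E x) : ℝ := (h.curvForm x a).trace.re

/-- `(E, h)` is RC-positive. -/
def IsRCPositive : Prop :=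
  ∀ (x : D) (a : E x), a ≠ 0 → ∃ v : Cn n, 0 < h.curvEval x v a

/-- `(E, h)` is RC-semipositive. -/
def IsRCSemipositive : Prop :=
  ∀ (x : D) (a : E x), a ≠ 0 → ∃ v : Cn n, v ≠ 0 ∧ 0 ≤ h.curvEval x v a

end HermitianMetric

/-- `f` is a smooth `E`-valued `(p,q)`-form on `D` with compact support. -/
def IsTestForm (r : ℕ) {E : D → Type*} [∀ x, AddCommGroup (E x)] [∀ x, Module ℂ (E x)]
    [∀ x, TopologicalSpace (E x)] [TopologicalSpace (TotalSpace (Fin r → ℂ) E)]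
    [FiberBundle (Fin r → ℂ) E] [VectorBundle ℂ (Fin r → ℂ) E] {p q : ℕ}
    (f : ∀ x, Form n p q (E x)) : Prop :=
  (∀ S, IsSmoothSection r fun x => f x S) ∧
    ∃ K : Set D, IsCompact K ∧ ∀ x, x ∉ K → f x = 0

/-- `∂̄u = f` in the sense of distributions, for an `E`-valued `(p,q)`-form `u` with locally integrable
coefficients. In a holomorphic frame, `∂̄u = ∑_k dz̄_k ∧ ∂u/∂z̄_k` componentwise; this is tested against
all smooth functions `φ` with compact support in the domain of the frame. -/
def IsWeakDbar (r : ℕ) {E : D → Type*} [∀ x, AddCommGroup (E x)] [∀ x, Module ℂ (E x)]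
    [∀ x, TopologicalSpace (E x)] [TopologicalSpace (TotalSpace (Fin r → ℂ) E)]
    [FiberBundle (Fin r → ℂ) E] [VectorBundle ℂ (Fin r → ℂ) E] {p q q' : ℕ}
    (u : ∀ x, Form n p q (E x)) (f : ∀ x, Form n p q' (E x)) : Prop :=
  ∀ (e : Trivialization (Fin r → ℂ) (π (Fin r → ℂ) E)) [MemTrivializationAtlas e],
    (∀ T, LocallyIntegrableOn (fun x => e.linearMapAt ℂ x (u x T)) e.baseSet (dVol D)) ∧
    ∀ φ : Cn n → ℂ, ContDiff ℝ ∞ φ → HasCompactSupport φ → tsupport φ ⊆ Subtype.val '' e.baseSet →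
      ∀ S : Idx n p q',
        ∫ x : D, φ x • e.linearMapAt ℂ x (f x S) ∂(dVol D) =
          - ∫ x : D, ∑ k, dbarDeriv k φ x •
              tensorId ((ext (dzbar k)).submatrix Subtype.val Subtype.val)
                (fun T => e.linearMapAt ℂ x (u x T)) S ∂(dVol D)

end Bundle

end RCPos

end

/-!
Everything happens near one point `p` of `D`, in a holomorphic frame with Gram matrix `H`. An
`(n,n)`-form has a single coefficient, and on such forms `[i∂∂̄ψ, Λ_ω]` is multiplication by
`Δψ = ∑_k ∂²ψ/∂z_k∂z̄_k` (`twistedOp_apply_univ`); for the weight `ψ = s |z - p|²` this is the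
constant `n s`.

Let `a` be a constant vector in the frame and `χ` a cut-off function. Solve `∂̄u = f` for
`f = (Δψ + c) χ a` and test the equation against `χ a` itself, in the metric `e^{-ψ} H`. The formal
adjoint of `∂̄` is given by the Chern derivatives `∇_k` of `e^{-ψ} H`, so that
`∫ (Δψ + c) |χ a|² e^{-ψ} ≤ ∑_k ∫ |u_k| |∇_k (χ a)| e^{-ψ}`, and the bound for `∫ |u|² e^{-ψ}`
turns this into `∫ (Δψ + c) |χ a|² e^{-ψ} ≤ ∑_k ∫ |∇_k (χ a)|² e^{-ψ}`
(`estimate_of_solvability`).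

By the Bochner–Kodaira identity (`bochner_kodaira`), two integrations by parts with
`[∇_k, ∂̄_k] = Θ_{kk} + ∂²ψ/∂z_k∂z̄_k` and `∂̄a = 0`, the right-hand side is
`∫ (∑_k (Θ_{kk} a, a) + Δψ |a|²) χ² e^{-ψ} + ∫ |∂̄χ|² |a|² e^{-ψ}`. The terms with `Δψ` cancel, and
`0 ≤ ∫ (∑_k (Θ_{kk} a, a) - c |a|²) χ² e^{-ψ} + ∫ |∂̄χ|² |a|² e^{-ψ}` remains for every `s > 0`. As
`s → ∞` the weights concentrate at `p`, where `∂̄χ = 0`, so the first integrand cannot be negative at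
`p` (`le_trace_curvMatrix_of_estimate`). Finally, if the trace of a form is positive (nonnegative),
so is one of its diagonal entries, which are its values at the coordinate vectors.
-/

namespace RCPos

/-! ### Wirtinger derivatives -/

section Wirtinger

variable {n : ℕ}

/-- The first-order operator `(∂/∂x_j + ε ∂/∂y_j)/2`. The values `ε = -i` and `ε = i` give
`∂/∂z_j` and `∂/∂z̄_j`, whose common formal properties are proved for all `ε` at once. -/
noncomputable def wirtinger (ε : ℂ) (j : Fin n) (g : Cn n → ℂ) (z : Cn n) : ℂ :=
  (1 / 2 : ℂ) * (fderiv ℝ g z (EuclideanSpace.single j 1)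
    + ε * fderiv ℝ g z (EuclideanSpace.single j Complex.I))

lemma dDeriv_eq_wirtinger (j : Fin n) (g : Cn n → ℂ) :
    dDeriv j g = wirtinger (-Complex.I) j g := by
  funext z
  simp only [dDeriv, wirtinger, smul_eq_mul]
  ring

lemma dbarDeriv_eq_wirtinger (j : Fin n) (g : Cn n → ℂ) :
    dbarDeriv j g = wirtinger Complex.I j g := by
  funext z
  simp only [dbarDeriv, wirtinger, smul_eq_mul]

variable {ε δ : ℂ} {j k : Fin n} {f g : Cn n → ℂ} {z : Cn n}

lemma wirtinger_add (hf : DifferentiableAt ℝ f z) (hg : DifferentiableAt ℝ g z) :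
    wirtinger ε j (fun w => f w + g w) z = wirtinger ε j f z + wirtinger ε j g z := by
  simp only [wirtinger, fderiv_fun_add hf hg, add_apply]
  ring

lemma wirtinger_sub (hf : DifferentiableAt ℝ f z) (hg : DifferentiableAt ℝ g z) :
    wirtinger ε j (fun w => f w - g w) z = wirtinger ε j f z - wirtinger ε j g z := by
  simp only [wirtinger, fderiv_fun_sub hf hg, sub_apply]
  ring

lemma wirtinger_sum {ι : Type*} {s : Finset ι} {F : ι → Cn n → ℂ}
    (hF : ∀ i ∈ s, DifferentiableAt ℝ (F i) z) :
    wirtinger ε j (fun w => ∑ i ∈ s, F i w) z = ∑ i ∈ s, wirtinger ε j (F i) z := by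
  simp only [wirtinger, fderiv_fun_sum hF, sum_apply, Finset.mul_sum,
    Finset.sum_add_distrib, mul_add]

lemma wirtinger_mul (hf : DifferentiableAt ℝ f z) (hg : DifferentiableAt ℝ g z) :
    wirtinger ε j (fun w => f w * g w) z = wirtinger ε j f z * g z + f z * wirtinger ε j g z := by
  simp only [wirtinger, fderiv_fun_mul hf hg, add_apply,
    smul_apply, smul_eq_mul]
  ring

lemma wirtinger_mul_const (hf : DifferentiableAt ℝ f z) (a : ℂ) :
    wirtinger ε j (fun w => f w * a) z = wirtinger ε j f z * a := by
  rw [wirtinger_mul hf (differentiableAt_const a)]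
  simp [wirtinger]

lemma wirtinger_const_mul (hf : DifferentiableAt ℝ f z) (a : ℂ) :
    wirtinger ε j (fun w => a * f w) z = a * wirtinger ε j f z := by
  simp only [mul_comm a, wirtinger_mul_const hf]

lemma wirtinger_exp_neg (hf : DifferentiableAt ℝ f z) :
    wirtinger ε j (fun w => Complex.exp (-f w)) z =
      -wirtinger ε j f z * Complex.exp (-f z) := by
  have h := (hf.hasFDerivAt.neg.cexp).fderiv
  erw [wirtinger, h]
  simp [wirtinger]
  ring

lemma wirtinger_congr (h : f =ᶠ[nhds z] g) : wirtinger ε j f z = wirtinger ε j g z := by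
  simp only [wirtinger, h.fderiv_eq]

lemma wirtinger_eq_zero_of_notMem_tsupport (h : z ∉ tsupport f) : wirtinger ε j f z = 0 := by
  rw [wirtinger_congr (notMem_tsupport_iff_eventuallyEq.1 h)]
  simp [wirtinger, Pi.zero_def]

lemma wirtinger_conj (hf : DifferentiableAt ℝ f z) :
    wirtinger ε j (fun w => conj (f w)) z = conj (wirtinger (conj ε) j f z) := by
  have h : fderiv ℝ (fun w => conj (f w)) z
      = (Complex.conjCLE : ℂ →L[ℝ] ℂ).comp (fderiv ℝ f z) :=
    ((Complex.conjCLE : ℂ →L[ℝ] ℂ).hasFDerivAt.comp z hf.hasFDerivAt).fderiv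
  have h2 : conj (2 : ℂ) = 2 := Complex.conj_ofNat 2
  simp [wirtinger, h, h2]

lemma wirtinger_ofReal {ψ : Cn n → ℝ} (hψ : DifferentiableAt ℝ ψ z) :
    conj (wirtinger ε j (fun w => (ψ w : ℂ)) z) = wirtinger (conj ε) j (fun w => (ψ w : ℂ)) z := by
  have h := wirtinger_conj (ε := conj ε) (j := j) (f := fun w => (ψ w : ℂ))
    (Complex.ofRealCLM.differentiableAt.comp z hψ)
  simpa using h.symm

lemma contDiffOn_wirtinger {U : Set (Cn n)} (hU : IsOpen U) (hf : ContDiffOn ℝ ∞ f U) :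
    ContDiffOn ℝ ∞ (wirtinger ε j f) U := by
  have h := hf.fderiv_of_isOpen (m := ∞) hU (by simp)
  unfold wirtinger
  fun_prop

lemma contDiff_wirtinger (hf : ContDiff ℝ ∞ f) : ContDiff ℝ ∞ (wirtinger ε j f) := by
  rw [← contDiffOn_univ] at hf ⊢
  exact contDiffOn_wirtinger isOpen_univ hf

lemma wirtinger_comm (hf : ContDiff ℝ ∞ f) :
    wirtinger ε j (wirtinger δ k f) z = wirtinger δ k (wirtinger ε j f) z := by
  have hd : DifferentiableAt ℝ (fderiv ℝ f) z :=
    (hf.fderiv_right (m := ∞) (by simp)).differentiable (by simp) z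
  have key : ∀ (ε : ℂ) (j : Fin n) (v : Cn n), fderiv ℝ (wirtinger ε j f) z v =
      (1 / 2 : ℂ) * (fderiv ℝ (fderiv ℝ f) z v (EuclideanSpace.single j 1)
        + ε * fderiv ℝ (fderiv ℝ f) z v (EuclideanSpace.single j Complex.I)) := by
    intro ε j v
    have h : ∀ u : Cn n, HasFDerivAt (fun w => fderiv ℝ f w u)
        ((fderiv ℝ (fderiv ℝ f) z).flip u) z := fun u => by
      simpa using hd.hasFDerivAt.clm_apply (hasFDerivAt_const u z)
    have h2 := ((h (EuclideanSpace.single j 1)).add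
      ((h (EuclideanSpace.single j Complex.I)).const_mul ε)).const_mul (1 / 2 : ℂ)
    have h3 := h2.fderiv
    unfold wirtinger
    erw [h3]
    simp
    ring
  have hs : IsSymmSndFDerivAt ℝ f z := hf.contDiffAt.isSymmSndFDerivAt (by simpa using ENat.LEInfty.out)
  simp only [wirtinger.eq_1 _ _ (wirtinger _ _ _), key]
  rw [hs (EuclideanSpace.single j 1) (EuclideanSpace.single k 1),
    hs (EuclideanSpace.single j 1) (EuclideanSpace.single k Complex.I),
    hs (EuclideanSpace.single j Complex.I) (EuclideanSpace.single k 1),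
    hs (EuclideanSpace.single j Complex.I) (EuclideanSpace.single k Complex.I)]
  ring

lemma integral_fderiv_eq_zero (hf : ContDiff ℝ ∞ f) (hc : HasCompactSupport f) (v : Cn n) :
    ∫ z, fderiv ℝ f z v = 0 := by
  have hi : Integrable (fun z => fderiv ℝ f z v) :=
    ((hf.continuous_fderiv (by simp)).clm_apply continuous_const).integrable_of_hasCompactSupport
      (hc.fderiv_apply (𝕜 := ℝ) v)
  have h := integral_mul_fderiv_eq_neg_fderiv_mul_of_integrable (μ := (volume : Measure (Cn n)))
    (f := fun _ => (1 : ℂ)) (g := f) (v := v) (by simp) (by simpa using hi)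
    (by simpa using hf.continuous.integrable_of_hasCompactSupport hc) (by simp)
    (fun x _ => hf.differentiable (by simp) x)
  simpa using h

/-- The divergence theorem in the form in which it is used for integration by parts. -/
lemma integral_wirtinger_eq_zero (hf : ContDiff ℝ ∞ f) (hc : HasCompactSupport f) :
    ∫ z, wirtinger ε j f z = 0 := by
  have hi : ∀ v, Integrable (fun z => fderiv ℝ f z v) := fun v =>
    ((hf.continuous_fderiv (by simp)).clm_apply continuous_const).integrable_of_hasCompactSupport
      (hc.fderiv_apply (𝕜 := ℝ) v)
  simp only [wirtinger]
  rw [integral_const_mul, integral_add (hi _) ((hi _).const_mul _), integral_const_mul,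
    integral_fderiv_eq_zero hf hc, integral_fderiv_eq_zero hf hc]
  simp

lemma hasCompactSupport_wirtinger (hc : HasCompactSupport f) :
    HasCompactSupport (wirtinger ε j f) :=
  hc.mono' fun z hz => by
    by_contra h
    exact hz (wirtinger_eq_zero_of_notMem_tsupport h)

/-- The product of a cut-off function with a function that is smooth near its support is smooth. -/
lemma contDiff_mul_of_tsupport_subset {U : Set (Cn n)} (hU : IsOpen U) (hf : ContDiff ℝ ∞ f)
    (hfU : tsupport f ⊆ U) (hg : ContDiffOn ℝ ∞ g U) : ContDiff ℝ ∞ (fun z => f z * g z) := by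
  refine contDiff_iff_contDiffAt.2 fun z => ?_
  by_cases hz : z ∈ tsupport fun z => f z * g z
  swap
  · exact contDiffAt_const.congr_of_eventuallyEq (notMem_tsupport_iff_eventuallyEq.1 hz)
  have hz' : z ∈ U := hfU (tsupport_mul_subset_left hz)
  exact hf.contDiffAt.mul (hg.contDiffAt (hU.mem_nhds hz'))

/-- `φ(z) = |z - p|²` satisfies `∂φ/∂z_j = conj (z_j - p_j)` and `∂φ/∂z̄_j = z_j - p_j`, here for
multiples of `φ`. -/
lemma wirtinger_normSq (s : ℝ) (p : Cn n) (ε : ℂ) :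
    wirtinger ε j (fun w => ((s * ‖w - p‖ ^ 2 : ℝ) : ℂ)) z =
      s * ((z j - p j).re + ε * (z j - p j).im) := by
  have h1 : HasFDerivAt (fun w : Cn n => ‖w - p‖ ^ 2) (2 • (innerSL ℝ (z - p))) z := by
    simpa using ((hasFDerivAt_id z).sub_const p).norm_sq
  have h2 : HasFDerivAt (fun w : Cn n => ((s * ‖w - p‖ ^ 2 : ℝ) : ℂ))
      (Complex.ofRealCLM.comp (s • (2 • (innerSL ℝ (z - p))))) z :=
    Complex.ofRealCLM.hasFDerivAt.comp z (h1.const_mul s)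
  have h3 : ∀ c : ℂ, inner ℝ (z - p) (EuclideanSpace.single j c : Cn n)
      = (z j - p j).re * c.re + (z j - p j).im * c.im := by
    intro c
    simp [PiLp.inner_apply, Complex.inner]
    rw [Finset.sum_eq_single j]
    · simp
      ring
    · intro b _ hb
      simp [hb]
    · simp
  simp only [wirtinger, h2.fderiv, ContinuousLinearMap.comp_apply, smul_apply, innerSL_apply_apply,
    h3]
  simp
  ring

end Wirtinger

/-! ### The Chern connection in a holomorphic frame -/

section Frame

variable {n r : ℕ} {U : Set (Cn n)} {H : Cn n → Matrix (Fin r) (Fin r) ℂ}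

/-- The sesquilinear form `∑ v_α M_{αβ} w̄_β` with Gram matrix `M`. -/
noncomputable def frameInner (M : Matrix (Fin r) (Fin r) ℂ) (v w : Fin r → ℂ) : ℂ :=
  ∑ α, ∑ β, v α * M α β * conj (w β)

/-- The Chern connection coefficients `A_j`, `A_jᵀ H = ∂_j H`, of the metric with Gram matrix `H`
in a holomorphic frame. -/
noncomputable def connMatrix (H : Cn n → Matrix (Fin r) (Fin r) ℂ) (j : Fin n) (z : Cn n) :
    Matrix (Fin r) (Fin r) ℂ :=
  ((Matrix.of fun α β => dDeriv j (fun w => H w α β) z) * (H z)⁻¹).transpose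

/-- The Chern curvature coefficients `Θ_{jk} = -∂A_j/∂z̄_k` of the metric with Gram matrix `H` in a
holomorphic frame. -/
noncomputable def curvMatrix (H : Cn n → Matrix (Fin r) (Fin r) ℂ) (j k : Fin n) (z : Cn n) :
    Matrix (Fin r) (Fin r) ℂ :=
  Matrix.of fun α β => - dbarDeriv k (fun w => connMatrix H j w α β) z

/-- The derivative `∇_k (χ a)`, in direction `∂/∂z_k`, of the section `χ a` (with `a` a constant
vector in a holomorphic frame) for the Chern connection of the metric `e^{-ψ} H`. -/
noncomputable def twistedCovDeriv (H : Cn n → Matrix (Fin r) (Fin r) ℂ) (χ ψ : Cn n → ℝ)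
    (a : Fin r → ℂ) (k : Fin n) (z : Cn n) : Fin r → ℂ := fun β =>
  dDeriv k (fun w => (χ w : ℂ)) z * a β + χ z * ((connMatrix H k z).mulVec a β -
    dDeriv k (fun w => (ψ w : ℂ)) z * a β)

/-- The components of the functional `(·, χ a)` given by the metric `e^{-ψ} H`, on a holomorphic
frame. -/
noncomputable def weightedDual (H : Cn n → Matrix (Fin r) (Fin r) ℂ) (χ ψ : Cn n → ℝ)
    (a : Fin r → ℂ) (β : Fin r) (z : Cn n) : ℂ :=
  χ z * (Complex.exp (-ψ z) * ∑ γ, H z β γ * conj (a γ))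

lemma contDiffOn_det (hH : ∀ α β, ContDiffOn ℝ ∞ (fun z => H z α β) U) :
    ContDiffOn ℝ ∞ (fun z => (H z).det) U := by
  simp only [Matrix.det_apply']
  exact ContDiffOn.sum fun σ _ => contDiffOn_const.mul (contDiffOn_prod fun i _ => hH _ _)

lemma contDiffOn_matrix_inv (hH : ∀ α β, ContDiffOn ℝ ∞ (fun z => H z α β) U)
    (hdet : ∀ z ∈ U, (H z).det ≠ 0) (α β : Fin r) :
    ContDiffOn ℝ ∞ (fun z => (H z)⁻¹ α β) U := by
  simp only [Matrix.inv_def, Matrix.smul_apply, Ring.inverse_eq_inv', smul_eq_mul,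
    Matrix.adjugate_apply]
  refine ((contDiffOn_det hH).inv hdet).mul (contDiffOn_det fun i j => ?_)
  by_cases h : i = β
  · subst h
    simpa using contDiffOn_const
  · simpa [Matrix.updateRow_ne h] using hH i j

variable (hU : IsOpen U) (hH : ∀ α β, ContDiffOn ℝ ∞ (fun z => H z α β) U)
  (hdet : ∀ z ∈ U, (H z).det ≠ 0)

include hU hH hdet in
lemma contDiffOn_connMatrix (k : Fin n) (α β : Fin r) :
    ContDiffOn ℝ ∞ (fun z => connMatrix H k z α β) U := by
  simp only [connMatrix, Matrix.transpose_apply, Matrix.mul_apply, Matrix.of_apply,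
    dDeriv_eq_wirtinger]
  exact ContDiffOn.sum fun i _ => (contDiffOn_wirtinger hU (hH _ _)).mul
    (contDiffOn_matrix_inv hH hdet _ _)

include hU hH hdet in
lemma contDiffOn_curvMatrix (j k : Fin n) (α β : Fin r) :
    ContDiffOn ℝ ∞ (fun z => curvMatrix H j k z α β) U := by
  simp only [curvMatrix, Matrix.of_apply, dbarDeriv_eq_wirtinger]
  exact (contDiffOn_wirtinger hU (contDiffOn_connMatrix hU hH hdet _ _ _)).neg

lemma contDiffOn_frameInner {v w : Cn n → Fin r → ℂ}
    (hH : ∀ α β, ContDiffOn ℝ ∞ (fun z => H z α β) U)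
    (hv : ∀ α, ContDiffOn ℝ ∞ (fun z => v z α) U) (hw : ∀ α, ContDiffOn ℝ ∞ (fun z => w z α) U) :
    ContDiffOn ℝ ∞ (fun z => frameInner (H z) (v z) (w z)) U := by
  have hw' : ∀ α, ContDiffOn ℝ ∞ (fun z => conj (w z α)) U := fun α =>
    (Complex.conjCLE : ℂ →L[ℝ] ℂ).contDiff.comp_contDiffOn (hw α)
  exact ContDiffOn.sum fun α _ => ContDiffOn.sum fun β _ => ((hv α).mul (hH α β)).mul (hw' β)

/-- The compatibility `(A_k a, ·)_H = ∂_k (a, ·)_H` of the connection with the metric. -/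
lemma sum_connMatrix_mul {z : Cn n} (hz : (H z).det ≠ 0) (k : Fin n) (a : Fin r → ℂ) (γ : Fin r) :
    ∑ β, (connMatrix H k z).mulVec a β * H z β γ
      = ∑ β, a β * dDeriv k (fun w => H w β γ) z := by
  have h : Matrix.vecMul ((connMatrix H k z).mulVec a) (H z)
      = Matrix.vecMul a (Matrix.of fun α β => dDeriv k (fun w => H w α β) z) := by
    rw [connMatrix, Matrix.mulVec_transpose, Matrix.vecMul_vecMul, Matrix.mul_assoc,
      Matrix.nonsing_inv_mul _ (isUnit_iff_ne_zero.2 hz), Matrix.mul_one]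
  simpa [Matrix.vecMul, dotProduct] using congrFun h γ

/-- The conjugate of `sum_connMatrix_mul`. -/
lemma sum_mul_conj_connMatrix (hU : IsOpen U) (hH : ∀ α β, ContDiffOn ℝ ∞ (fun z => H z α β) U)
    (hdet : ∀ z ∈ U, (H z).det ≠ 0) (hherm : ∀ z ∈ U, ∀ α β, H z β α = conj (H z α β))
    {z : Cn n} (hz : z ∈ U) (k : Fin n) (a : Fin r → ℂ) (β : Fin r) :
    ∑ γ, H z β γ * conj ((connMatrix H k z).mulVec a γ)
      = ∑ γ, dbarDeriv k (fun w => H w β γ) z * conj (a γ) := by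
  have h := congrArg conj (sum_connMatrix_mul (hdet z hz) k a β)
  simp only [map_sum, map_mul, ← hherm z hz _ _] at h
  have h2 : ∀ γ, dbarDeriv k (fun w => H w β γ) z = conj (dDeriv k (fun w => H w γ β) z) := by
    intro γ
    have hd : DifferentiableAt ℝ (fun w => H w γ β) z :=
      ((hH γ β).contDiffAt (hU.mem_nhds hz)).differentiableAt (by simp)
    rw [dDeriv_eq_wirtinger, dbarDeriv_eq_wirtinger,
      show (-Complex.I) = conj Complex.I by simp, ← wirtinger_conj hd]
    refine wirtinger_congr ?_
    filter_upwards [hU.mem_nhds hz] with w hw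
    exact hherm w hw _ _
  simp only [h2]
  simpa only [mul_comm] using h

section Bochner

variable (hherm : ∀ z ∈ U, ∀ α β, H z β α = conj (H z α β))
  {χ ψ : Cn n → ℝ} (hχ : ContDiff ℝ ∞ χ) (hψ : ContDiff ℝ ∞ ψ)

include hU hH hdet hherm hχ hψ in
/-- The metric `e^{-ψ} H` is parallel: `∂̄_k (·, χ a) = (·, ∇_k (χ a))` on a holomorphic frame. -/
lemma dbarDeriv_weightedDual {z : Cn n} (hz : z ∈ U) (k : Fin n) (a : Fin r → ℂ) (β : Fin r) :
    dbarDeriv k (weightedDual H χ ψ a β) z =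
      Complex.exp (-ψ z) *
        ∑ γ, H z β γ * conj (twistedCovDeriv H χ ψ a k z γ) := by
  have hHd : ∀ α β, DifferentiableAt ℝ (fun w => H w α β) z := fun α β =>
    ((hH α β).contDiffAt (hU.mem_nhds hz)).differentiableAt (by simp)
  have hχr : DifferentiableAt ℝ χ z := hχ.differentiable (by simp) z
  have hψr : DifferentiableAt ℝ ψ z := hψ.differentiable (by simp) z
  have hχd : DifferentiableAt ℝ (fun w => (χ w : ℂ)) z :=
    Complex.ofRealCLM.differentiableAt.comp z hχr
  have hψd : DifferentiableAt ℝ (fun w => (ψ w : ℂ)) z :=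
    Complex.ofRealCLM.differentiableAt.comp z hψr
  have hed : DifferentiableAt ℝ (fun w => Complex.exp (-(ψ w : ℂ))) z := hψd.neg.cexp
  have hsd : DifferentiableAt ℝ (fun w => ∑ γ, H w β γ * conj (a γ)) z :=
    DifferentiableAt.fun_sum fun γ _ => (hHd β γ).mul_const _
  have e1 : conj (dDeriv k (fun w => (χ w : ℂ)) z) = dbarDeriv k (fun w => (χ w : ℂ)) z := by
    rw [dDeriv_eq_wirtinger, dbarDeriv_eq_wirtinger, wirtinger_ofReal hχr]; simp
  have e2 : conj (dDeriv k (fun w => (ψ w : ℂ)) z) = dbarDeriv k (fun w => (ψ w : ℂ)) z := by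
    rw [dDeriv_eq_wirtinger, dbarDeriv_eq_wirtinger, wirtinger_ofReal hψr]; simp
  have e3 := sum_mul_conj_connMatrix hU hH hdet hherm hz k a β
  have lhs : dbarDeriv k (weightedDual H χ ψ a β) z =
      dbarDeriv k (fun w => (χ w : ℂ)) z * (Complex.exp (-ψ z) * ∑ γ, H z β γ * conj (a γ))
      + χ z * (-dbarDeriv k (fun w => (ψ w : ℂ)) z * Complex.exp (-ψ z) *
          (∑ γ, H z β γ * conj (a γ)) +
        Complex.exp (-ψ z) * ∑ γ, dbarDeriv k (fun w => H w β γ) z * conj (a γ)) := by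
    simp only [dbarDeriv_eq_wirtinger] at e3 ⊢
    unfold weightedDual
    rw [wirtinger_mul hχd (hed.fun_mul hsd), wirtinger_mul hed hsd, wirtinger_exp_neg hψd,
      wirtinger_sum (fun γ _ => (hHd β γ).mul_const _)]
    simp only [wirtinger_mul_const (hHd β _)]
  rw [lhs, ← e3]
  simp only [twistedCovDeriv, map_add, map_mul, map_sub, Complex.conj_ofReal, e1, e2, mul_add,
    mul_sub, Finset.sum_add_distrib, Finset.sum_sub_distrib, Finset.mul_sum]
  rw [← Finset.sum_add_distrib, ← Finset.sum_add_distrib, ← Finset.sum_sub_distrib,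
    ← Finset.sum_add_distrib]
  exact Finset.sum_congr rfl fun γ _ => by ring

include hU hH hdet hχ hψ in
lemma contDiffOn_twistedCovDeriv (k : Fin n) (a : Fin r → ℂ) (β : Fin r) :
    ContDiffOn ℝ ∞ (fun z => twistedCovDeriv H χ ψ a k z β) U := by
  have hχc : ContDiff ℝ ∞ (fun w => (χ w : ℂ)) := Complex.ofRealCLM.contDiff.comp hχ
  have hψc : ContDiff ℝ ∞ (fun w => (ψ w : ℂ)) := Complex.ofRealCLM.contDiff.comp hψ
  simp only [twistedCovDeriv, Matrix.mulVec, dotProduct, dDeriv_eq_wirtinger]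
  exact ((contDiff_wirtinger hχc).contDiffOn.mul contDiffOn_const).add (hχc.contDiffOn.mul
    ((ContDiffOn.sum fun γ _ => (contDiffOn_connMatrix hU hH hdet k β γ).mul contDiffOn_const).sub
      ((contDiff_wirtinger hψc).contDiffOn.mul contDiffOn_const)))

include hH hψ in
lemma contDiffOn_exp_mul_sum (a : Fin r → ℂ) (β : Fin r) :
    ContDiffOn ℝ ∞ (fun z => Complex.exp (-ψ z) * ∑ γ, H z β γ * conj (a γ)) U := by
  have hψc : ContDiff ℝ ∞ (fun w => (ψ w : ℂ)) := Complex.ofRealCLM.contDiff.comp hψ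
  exact hψc.neg.cexp.contDiffOn.mul (ContDiffOn.sum fun γ _ => (hH β γ).mul contDiffOn_const)

include hH hχ hψ in
lemma contDiffOn_weightedDual (a : Fin r → ℂ) (β : Fin r) :
    ContDiffOn ℝ ∞ (weightedDual H χ ψ a β) U := by
  have hχc : ContDiff ℝ ∞ (fun w => (χ w : ℂ)) := Complex.ofRealCLM.contDiff.comp hχ
  exact hχc.contDiffOn.mul (contDiffOn_exp_mul_sum hH hψ a β)

lemma frameInner_eq_sum_mul (M : Matrix (Fin r) (Fin r) ℂ) (v w : Fin r → ℂ) :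
    frameInner M v w = ∑ β, v β * ∑ γ, M β γ * conj (w γ) := by
  simp only [frameInner, Finset.mul_sum, mul_assoc]

include hU hH hdet hχ hψ in
/-- The commutator of `∇_k` and `∂̄_k` is the curvature of `e^{-ψ} H`, since the frame is holomorphic. -/
lemma dbarDeriv_twistedCovDeriv {z : Cn n} (hz : z ∈ U) (k : Fin n) (a : Fin r → ℂ) (β : Fin r) :
    dbarDeriv k (fun w => twistedCovDeriv H χ ψ a k w β) z =
      dbarDeriv k (dDeriv k fun w => (χ w : ℂ)) z * a β +
      dbarDeriv k (fun w => (χ w : ℂ)) z *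
        ((connMatrix H k z).mulVec a β - dDeriv k (fun w => (ψ w : ℂ)) z * a β) -
      χ z * ((curvMatrix H k k z).mulVec a β +
        dbarDeriv k (dDeriv k fun w => (ψ w : ℂ)) z * a β) := by
  have hχc : ContDiff ℝ ∞ (fun w => (χ w : ℂ)) := Complex.ofRealCLM.contDiff.comp hχ
  have hψc : ContDiff ℝ ∞ (fun w => (ψ w : ℂ)) := Complex.ofRealCLM.contDiff.comp hψ
  have hA : ∀ γ, DifferentiableAt ℝ (fun w => connMatrix H k w β γ) z := fun γ =>
    ((contDiffOn_connMatrix hU hH hdet k β γ).contDiffAt (hU.mem_nhds hz)).differentiableAt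
      (by simp)
  have hχ1 : DifferentiableAt ℝ (wirtinger (-Complex.I) k fun w => (χ w : ℂ)) z :=
    (contDiff_wirtinger hχc).differentiable (by simp) z
  have hψ1 : DifferentiableAt ℝ (wirtinger (-Complex.I) k fun w => (ψ w : ℂ)) z :=
    (contDiff_wirtinger hψc).differentiable (by simp) z
  have hs : DifferentiableAt ℝ (fun w => ∑ γ, connMatrix H k w β γ * a γ) z :=
    DifferentiableAt.fun_sum fun γ _ => (hA γ).mul_const _
  simp only [twistedCovDeriv, curvMatrix, Matrix.mulVec, dotProduct, Matrix.of_apply,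
    dDeriv_eq_wirtinger, dbarDeriv_eq_wirtinger]
  rw [wirtinger_add (hχ1.mul_const _) ((hχc.differentiable (by simp) z).fun_mul
      (hs.fun_sub (hψ1.mul_const _))), wirtinger_mul_const hχ1,
    wirtinger_mul (hχc.differentiable (by simp) z) (hs.fun_sub (hψ1.mul_const _)),
    wirtinger_sub hs (hψ1.mul_const _), wirtinger_mul_const hψ1,
    wirtinger_sum (fun γ _ => (hA γ).mul_const _)]
  simp only [wirtinger_mul_const (hA _), neg_mul, Finset.sum_neg_distrib]
  ring

include hU hH hdet in
lemma dDeriv_frameInner_const {z : Cn n} (hz : z ∈ U) (k : Fin n) (a : Fin r → ℂ) :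
    dDeriv k (fun w => frameInner (H w) a a) z =
      frameInner (H z) ((connMatrix H k z).mulVec a) a := by
  have hHd : ∀ α β, DifferentiableAt ℝ (fun w => H w α β) z := fun α β =>
    ((hH α β).contDiffAt (hU.mem_nhds hz)).differentiableAt (by simp)
  have h := sum_connMatrix_mul (hdet z hz) k a
  simp only [frameInner]
  rw [Finset.sum_comm]
  simp only [← Finset.sum_mul, h]
  simp only [dDeriv_eq_wirtinger]
  rw [wirtinger_sum (fun α _ => DifferentiableAt.fun_sum fun β _ =>
    ((hHd α β).const_mul _).mul_const _)]
  simp only [wirtinger_sum (fun β _ => ((hHd _ β).const_mul _).mul_const _),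
    wirtinger_mul_const ((hHd _ _).const_mul _), wirtinger_const_mul (hHd _ _), Finset.sum_mul]
  exact Finset.sum_comm

include hU hH hdet hherm hχ hψ in
/-- The Bochner–Kodaira identity before integration: `|∇_k (χ a)|²` differs from the curvature term
by two divergences and by a term that lives where `χ` is not constant. -/
lemma norm_twistedCovDeriv_eq {z : Cn n} (hz : z ∈ U) (k : Fin n) (a : Fin r → ℂ) :
    Complex.exp (-ψ z) *
        frameInner (H z) (twistedCovDeriv H χ ψ a k z) (twistedCovDeriv H χ ψ a k z) =
      dbarDeriv k (fun w => ∑ β, twistedCovDeriv H χ ψ a k w β * weightedDual H χ ψ a β w) z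
      - dDeriv k (fun w => χ w * (dbarDeriv k (fun w => (χ w : ℂ)) w *
          (Complex.exp (-ψ w) * frameInner (H w) a a))) z
      + χ z * (χ z * (Complex.exp (-ψ z) * (frameInner (H z) ((curvMatrix H k k z).mulVec a) a +
          dbarDeriv k (dDeriv k fun w => (ψ w : ℂ)) z * frameInner (H z) a a)))
      + dbarDeriv k (fun w => (χ w : ℂ)) z * (dDeriv k (fun w => (χ w : ℂ)) z *
          (Complex.exp (-ψ z) * frameInner (H z) a a)) := by
  have hχc : ContDiff ℝ ∞ (fun w => (χ w : ℂ)) := Complex.ofRealCLM.contDiff.comp hχ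
  have hψc : ContDiff ℝ ∞ (fun w => (ψ w : ℂ)) := Complex.ofRealCLM.contDiff.comp hψ
  have hec : ContDiff ℝ ∞ (fun w => Complex.exp (-(ψ w : ℂ))) := hψc.neg.cexp
  have hdiff : ∀ {g : Cn n → ℂ}, ContDiffOn ℝ ∞ g U → DifferentiableAt ℝ g z := fun hg =>
    (hg.contDiffAt (hU.mem_nhds hz)).differentiableAt (by simp)
  have hχ1 : ContDiff ℝ ∞ (dbarDeriv k fun w => (χ w : ℂ)) := by
    rw [dbarDeriv_eq_wirtinger]; exact contDiff_wirtinger hχc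
  have hG : ContDiffOn ℝ ∞ (fun w => frameInner (H w) a a) U :=
    contDiffOn_frameInner hH (fun _ => contDiffOn_const) (fun _ => contDiffOn_const)
  have hw := contDiffOn_twistedCovDeriv hU hH hdet hχ hψ k a
  have hφ := contDiffOn_weightedDual hH hχ hψ a
  have e1 : dbarDeriv k (fun w => ∑ β, twistedCovDeriv H χ ψ a k w β * weightedDual H χ ψ a β w) z
      = ∑ β, (dbarDeriv k (fun w => twistedCovDeriv H χ ψ a k w β) z * weightedDual H χ ψ a β z +
          twistedCovDeriv H χ ψ a k z β * dbarDeriv k (weightedDual H χ ψ a β) z) := by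
    simp only [dbarDeriv_eq_wirtinger]
    rw [wirtinger_sum fun β _ => (hdiff (hw β)).fun_mul (hdiff (hφ β))]
    exact Finset.sum_congr rfl fun β _ => wirtinger_mul (hdiff (hw β)) (hdiff (hφ β))
  have e2 : dDeriv k (fun w => χ w * (dbarDeriv k (fun w => (χ w : ℂ)) w *
          (Complex.exp (-ψ w) * frameInner (H w) a a))) z =
      dDeriv k (fun w => (χ w : ℂ)) z * (dbarDeriv k (fun w => (χ w : ℂ)) z *
          (Complex.exp (-ψ z) * frameInner (H z) a a)) +
      χ z * (dbarDeriv k (dDeriv k fun w => (χ w : ℂ)) z *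
          (Complex.exp (-ψ z) * frameInner (H z) a a) +
        dbarDeriv k (fun w => (χ w : ℂ)) z *
          (-dDeriv k (fun w => (ψ w : ℂ)) z * Complex.exp (-ψ z) * frameInner (H z) a a +
            Complex.exp (-ψ z) * frameInner (H z) ((connMatrix H k z).mulVec a) a)) := by
    have h1 := hχc.differentiable (by simp) z
    have h2 := hχ1.differentiable (by simp) z
    have h3 := hec.differentiable (by simp) z
    have h4 := hdiff hG
    rw [← dDeriv_frameInner_const hU hH hdet hz]
    simp only [dDeriv_eq_wirtinger, dbarDeriv_eq_wirtinger] at h2 ⊢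
    rw [wirtinger_mul h1 (h2.fun_mul (h3.fun_mul h4)), wirtinger_mul h2 (h3.fun_mul h4),
      wirtinger_mul h3 h4, wirtinger_exp_neg (hψc.differentiable (by simp) z),
      wirtinger_comm hχc]
  have e3 : ∑ β, twistedCovDeriv H χ ψ a k z β * dbarDeriv k (weightedDual H χ ψ a β) z =
      Complex.exp (-ψ z) *
        frameInner (H z) (twistedCovDeriv H χ ψ a k z) (twistedCovDeriv H χ ψ a k z) := by
    rw [frameInner_eq_sum_mul, Finset.mul_sum]
    refine Finset.sum_congr rfl fun β _ => ?_
    rw [dbarDeriv_weightedDual hU hH hdet hherm hχ hψ hz]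
    ring
  rw [e1, e2, Finset.sum_add_distrib, e3]
  simp only [dbarDeriv_twistedCovDeriv hU hH hdet hχ hψ hz, weightedDual, frameInner_eq_sum_mul]
  have e4 : ∀ (p q t u x y : ℂ) (b c d S : Fin r → ℂ),
      ∑ β, (p * b β + q * (c β - t * b β) - x * (d β + u * b β)) * (x * (y * S β)) =
        x * y * (p * (∑ β, b β * S β) + q * ((∑ β, c β * S β) - t * ∑ β, b β * S β)
          - x * ((∑ β, d β * S β) + u * ∑ β, b β * S β)) := by
    intro p q t u x y b c d S
    simp only [Finset.mul_sum, ← Finset.sum_sub_distrib, ← Finset.sum_add_distrib]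
    exact Finset.sum_congr rfl fun β _ => by ring
  rw [e4]
  ring

end Bochner
end Frame

/-! ### The integrated Bochner–Kodaira identity -/

section Integrated

variable {n r : ℕ} {U : Set (Cn n)} {H : Cn n → Matrix (Fin r) (Fin r) ℂ}

lemma tsupport_wirtinger_subset {ε : ℂ} {j : Fin n} {f : Cn n → ℂ} :
    tsupport (wirtinger ε j f) ⊆ tsupport f :=
  closure_minimal (fun _ hz => by_contra fun h => hz (wirtinger_eq_zero_of_notMem_tsupport h))
    (isClosed_tsupport f)

lemma tsupport_ofReal (χ : Cn n → ℝ) : tsupport (fun w => (χ w : ℂ)) = tsupport χ := by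
  simp [tsupport, Function.support]

lemma twistedCovDeriv_eq_zero {H : Cn n → Matrix (Fin r) (Fin r) ℂ} {χ ψ : Cn n → ℝ}
    {a : Fin r → ℂ} {k : Fin n} {z : Cn n} (hz : z ∉ tsupport χ) :
    twistedCovDeriv H χ ψ a k z = 0 := by
  have h1 : dDeriv k (fun w => (χ w : ℂ)) z = 0 := by
    rw [dDeriv_eq_wirtinger]
    exact wirtinger_eq_zero_of_notMem_tsupport (by rwa [tsupport_ofReal])
  funext β
  simp [twistedCovDeriv, h1, image_eq_zero_of_notMem_tsupport hz]

lemma integrable_mul_of_tsupport_subset {f g : Cn n → ℂ} (hU : IsOpen U) (hf : ContDiff ℝ ∞ f)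
    (hfc : HasCompactSupport f) (hfU : tsupport f ⊆ U) (hg : ContDiffOn ℝ ∞ g U) :
    Integrable (fun z => f z * g z) :=
  (contDiff_mul_of_tsupport_subset hU hf hfU hg).continuous.integrable_of_hasCompactSupport
    hfc.mul_right

variable (hU : IsOpen U) (hH : ∀ α β, ContDiffOn ℝ ∞ (fun z => H z α β) U)
  (hdet : ∀ z ∈ U, (H z).det ≠ 0) (hherm : ∀ z ∈ U, ∀ α β, H z β α = conj (H z α β))
  {χ ψ : Cn n → ℝ} (hχ : ContDiff ℝ ∞ χ) (hψ : ContDiff ℝ ∞ ψ)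
  (hc : HasCompactSupport χ) (hχU : tsupport χ ⊆ U)

include hU hH hdet hherm hχ hψ hc hχU in
/-- The integral of `norm_twistedCovDeriv_eq`: the two divergences drop out. -/
lemma integral_norm_twistedCovDeriv (k : Fin n) (a : Fin r → ℂ) :
    Integrable (fun z => Complex.exp (-ψ z) *
        frameInner (H z) (twistedCovDeriv H χ ψ a k z) (twistedCovDeriv H χ ψ a k z)) ∧
    Integrable (fun z => χ z * (χ z * (Complex.exp (-ψ z) *
        (frameInner (H z) ((curvMatrix H k k z).mulVec a) a +
          dbarDeriv k (dDeriv k fun w => (ψ w : ℂ)) z * frameInner (H z) a a)))) ∧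
    Integrable (fun z => dbarDeriv k (fun w => (χ w : ℂ)) z * (dDeriv k (fun w => (χ w : ℂ)) z *
          (Complex.exp (-ψ z) * frameInner (H z) a a))) ∧
    ∫ z, Complex.exp (-ψ z) *
        frameInner (H z) (twistedCovDeriv H χ ψ a k z) (twistedCovDeriv H χ ψ a k z) =
      (∫ z, χ z * (χ z * (Complex.exp (-ψ z) *
        (frameInner (H z) ((curvMatrix H k k z).mulVec a) a +
          dbarDeriv k (dDeriv k fun w => (ψ w : ℂ)) z * frameInner (H z) a a)))) +
      ∫ z, dbarDeriv k (fun w => (χ w : ℂ)) z * (dDeriv k (fun w => (χ w : ℂ)) z *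
          (Complex.exp (-ψ z) * frameInner (H z) a a)) := by
  have hχc : ContDiff ℝ ∞ (fun w => (χ w : ℂ)) := Complex.ofRealCLM.contDiff.comp hχ
  have hψc : ContDiff ℝ ∞ (fun w => (ψ w : ℂ)) := Complex.ofRealCLM.contDiff.comp hψ
  have hec : ContDiff ℝ ∞ (fun w => Complex.exp (-(ψ w : ℂ))) := hψc.neg.cexp
  have hcc : HasCompactSupport (fun w => (χ w : ℂ)) := by
    rwa [HasCompactSupport, tsupport_ofReal]
  have hUc : tsupport (fun w => (χ w : ℂ)) ⊆ U := by rwa [tsupport_ofReal]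
  have hG : ContDiffOn ℝ ∞ (fun w => frameInner (H w) a a) U :=
    contDiffOn_frameInner hH (fun _ => contDiffOn_const) (fun _ => contDiffOn_const)
  have hPG : ContDiffOn ℝ ∞ (fun w => Complex.exp (-(ψ w : ℂ)) * frameInner (H w) a a) U :=
    hec.contDiffOn.mul hG
  have hw := contDiffOn_twistedCovDeriv hU hH hdet hχ hψ k a
  -- the two vector fields whose divergences integrate to zero
  have hF : ContDiffOn ℝ ∞ (fun w => ∑ β, twistedCovDeriv H χ ψ a k w β *
      (Complex.exp (-ψ w) * ∑ γ, H w β γ * conj (a γ))) U :=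
    ContDiffOn.sum fun β _ => (hw β).mul (contDiffOn_exp_mul_sum hH hψ a β)
  have hFeq : (fun w => ∑ β, twistedCovDeriv H χ ψ a k w β * weightedDual H χ ψ a β w) =
      fun w => χ w * ∑ β, twistedCovDeriv H χ ψ a k w β *
        (Complex.exp (-ψ w) * ∑ γ, H w β γ * conj (a γ)) := by
    funext w
    rw [Finset.mul_sum]
    exact Finset.sum_congr rfl fun β _ => by rw [weightedDual]; ring
  have hF1 := contDiff_mul_of_tsupport_subset hU hχc hUc hF
  have hF2 : HasCompactSupport (fun w => (χ w : ℂ) * ∑ β, twistedCovDeriv H χ ψ a k w β *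
        (Complex.exp (-ψ w) * ∑ γ, H w β γ * conj (a γ))) := hcc.mul_right
  rw [← hFeq] at hF1 hF2
  have hK : ContDiffOn ℝ ∞ (fun w => dbarDeriv k (fun w => (χ w : ℂ)) w *
      (Complex.exp (-ψ w) * frameInner (H w) a a)) U := by
    rw [dbarDeriv_eq_wirtinger]
    exact (contDiff_wirtinger hχc).contDiffOn.mul hPG
  have hK1 := contDiff_mul_of_tsupport_subset hU hχc hUc hK
  have hK2 : HasCompactSupport (fun w => (χ w : ℂ) * (dbarDeriv k (fun w => (χ w : ℂ)) w *
      (Complex.exp (-ψ w) * frameInner (H w) a a))) := hcc.mul_right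
  -- off `U` both sides vanish, because `χ` vanishes near such points
  have key : (fun z => Complex.exp (-ψ z) *
        frameInner (H z) (twistedCovDeriv H χ ψ a k z) (twistedCovDeriv H χ ψ a k z)) = fun z =>
      dbarDeriv k (fun w => ∑ β, twistedCovDeriv H χ ψ a k w β * weightedDual H χ ψ a β w) z
      - dDeriv k (fun w => χ w * (dbarDeriv k (fun w => (χ w : ℂ)) w *
          (Complex.exp (-ψ w) * frameInner (H w) a a))) z
      + χ z * (χ z * (Complex.exp (-ψ z) * (frameInner (H z) ((curvMatrix H k k z).mulVec a) a +
          dbarDeriv k (dDeriv k fun w => (ψ w : ℂ)) z * frameInner (H z) a a)))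
      + dbarDeriv k (fun w => (χ w : ℂ)) z * (dDeriv k (fun w => (χ w : ℂ)) z *
          (Complex.exp (-ψ z) * frameInner (H z) a a)) := by
    funext z
    by_cases hz : z ∈ U
    · exact norm_twistedCovDeriv_eq hU hH hdet hherm hχ hψ hz k a
    have hz1 : z ∉ tsupport (fun w => (χ w : ℂ)) := fun h => hz (hUc h)
    have h0 : (χ z : ℂ) = 0 := image_eq_zero_of_notMem_tsupport (f := fun w => (χ w : ℂ)) hz1
    have h2 : dbarDeriv k (fun w => (χ w : ℂ)) z = 0 := by
      rw [dbarDeriv_eq_wirtinger]; exact wirtinger_eq_zero_of_notMem_tsupport hz1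
    have h3 : twistedCovDeriv H χ ψ a k z = 0 :=
      twistedCovDeriv_eq_zero (by rwa [tsupport_ofReal] at hz1)
    rw [hFeq, dbarDeriv_eq_wirtinger, dDeriv_eq_wirtinger,
      wirtinger_eq_zero_of_notMem_tsupport fun h => hz1 (tsupport_mul_subset_left h),
      wirtinger_eq_zero_of_notMem_tsupport fun h => hz1 (tsupport_mul_subset_left h),
      h3, h0, h2]
    simp [frameInner]
  have i1 : Integrable (dbarDeriv k
      (fun w => ∑ β, twistedCovDeriv H χ ψ a k w β * weightedDual H χ ψ a β w)) := by
    rw [dbarDeriv_eq_wirtinger]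
    exact (contDiff_wirtinger hF1).continuous.integrable_of_hasCompactSupport
      (hasCompactSupport_wirtinger hF2)
  have i2 : Integrable (dDeriv k (fun w => χ w * (dbarDeriv k (fun w => (χ w : ℂ)) w *
          (Complex.exp (-ψ w) * frameInner (H w) a a)))) := by
    rw [dDeriv_eq_wirtinger]
    exact (contDiff_wirtinger hK1).continuous.integrable_of_hasCompactSupport
      (hasCompactSupport_wirtinger hK2)
  have i3 : Integrable (fun z => χ z * (χ z * (Complex.exp (-ψ z) *
        (frameInner (H z) ((curvMatrix H k k z).mulVec a) a +
          dbarDeriv k (dDeriv k fun w => (ψ w : ℂ)) z * frameInner (H z) a a)))) := by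
    have hΘ : ContDiffOn ℝ ∞
        (fun z => frameInner (H z) ((curvMatrix H k k z).mulVec a) a) U := by
      refine contDiffOn_frameInner (v := fun z => (curvMatrix H k k z).mulVec a)
        (w := fun _ => a) hH (fun α => ?_) (fun _ => contDiffOn_const)
      simp only [Matrix.mulVec, dotProduct]
      exact ContDiffOn.sum fun γ _ =>
        (contDiffOn_curvMatrix hU hH hdet k k α γ).mul contDiffOn_const
    have hL : ContDiffOn ℝ ∞ (dbarDeriv k (dDeriv k fun w => (ψ w : ℂ))) U := by
      rw [dbarDeriv_eq_wirtinger, dDeriv_eq_wirtinger]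
      exact (contDiff_wirtinger (contDiff_wirtinger hψc)).contDiffOn
    exact integrable_mul_of_tsupport_subset hU hχc hcc hUc
      (hχc.contDiffOn.mul (hec.contDiffOn.mul (hΘ.add (hL.mul hG))))
  have i4 : Integrable (fun z => dbarDeriv k (fun w => (χ w : ℂ)) z *
      (dDeriv k (fun w => (χ w : ℂ)) z * (Complex.exp (-ψ z) * frameInner (H z) a a))) := by
    rw [dbarDeriv_eq_wirtinger, dDeriv_eq_wirtinger]
    exact integrable_mul_of_tsupport_subset hU (contDiff_wirtinger hχc)
      (hasCompactSupport_wirtinger hcc) (tsupport_wirtinger_subset.trans hUc)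
      ((contDiff_wirtinger hχc).contDiffOn.mul hPG)
  have i12 := i1.sub i2
  have i123 := i12.add i3
  refine ⟨key ▸ i123.add i4, i3, i4, ?_⟩
  rw [key]
  have e1 := integral_add i123 i4
  have e2 := integral_add i12 i3
  have e3 := integral_sub i1 i2
  simp only [Pi.add_apply, Pi.sub_apply] at e1 e2 e3
  rw [e1, e2, e3, dbarDeriv_eq_wirtinger, dDeriv_eq_wirtinger, integral_wirtinger_eq_zero hF1 hF2,
    integral_wirtinger_eq_zero hK1 hK2]
  simp

include hU hH hdet hherm hχ hψ hc hχU in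
/-- The Bochner–Kodaira identity for `χ a`, when the weight has constant complex Hessian
`∂²ψ/∂z_k∂z̄_k = s`. -/
lemma bochner_kodaira (a : Fin r → ℂ) (s : ℝ)
    (hs : ∀ k z, dbarDeriv k (dDeriv k fun w => (ψ w : ℂ)) z = s) :
    Integrable (fun z => Real.exp (-ψ z) * ∑ k, (frameInner (H z) (twistedCovDeriv H χ ψ a k z)
        (twistedCovDeriv H χ ψ a k z)).re) ∧
    Integrable (fun z => Real.exp (-ψ z) * (χ z ^ 2 *
        ∑ k, (frameInner (H z) ((curvMatrix H k k z).mulVec a) a).re)) ∧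
    Integrable (fun z => Real.exp (-ψ z) * (χ z ^ 2 * (frameInner (H z) a a).re)) ∧
    Integrable (fun z => Real.exp (-ψ z) * ((∑ k, ‖dbarDeriv k (fun w => (χ w : ℂ)) z‖ ^ 2) *
        (frameInner (H z) a a).re)) ∧
    ∫ z, Real.exp (-ψ z) * ∑ k, (frameInner (H z) (twistedCovDeriv H χ ψ a k z)
        (twistedCovDeriv H χ ψ a k z)).re =
      (∫ z, Real.exp (-ψ z) * (χ z ^ 2 *
        ∑ k, (frameInner (H z) ((curvMatrix H k k z).mulVec a) a).re)) +
      n * s * (∫ z, Real.exp (-ψ z) * (χ z ^ 2 * (frameInner (H z) a a).re)) +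
      ∫ z, Real.exp (-ψ z) * ((∑ k, ‖dbarDeriv k (fun w => (χ w : ℂ)) z‖ ^ 2) *
        (frameInner (H z) a a).re) := by
  have hχc : ContDiff ℝ ∞ (fun w => (χ w : ℂ)) := Complex.ofRealCLM.contDiff.comp hχ
  have hψc : ContDiff ℝ ∞ (fun w => (ψ w : ℂ)) := Complex.ofRealCLM.contDiff.comp hψ
  have hcc : HasCompactSupport (fun w => (χ w : ℂ)) := by
    rwa [HasCompactSupport, tsupport_ofReal]
  have hUc : tsupport (fun w => (χ w : ℂ)) ⊆ U := by rwa [tsupport_ofReal]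
  have hG : ContDiffOn ℝ ∞ (fun w => frameInner (H w) a a) U :=
    contDiffOn_frameInner hH (fun _ => contDiffOn_const) (fun _ => contDiffOn_const)
  have hexp : ∀ z, Complex.exp (-(ψ z : ℂ)) = (Real.exp (-ψ z) : ℝ) := fun z => by simp
  have iG : Integrable (fun z => Real.exp (-ψ z) * (χ z ^ 2 * (frameInner (H z) a a).re)) := by
    have h := (integrable_mul_of_tsupport_subset hU hχc hcc hUc
      (hχc.contDiffOn.mul (hψc.neg.cexp.contDiffOn.mul hG))).re
    refine h.congr (Filter.Eventually.of_forall fun z => ?_)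
    simp only [hexp, RCLike.re_to_complex, Complex.re_ofReal_mul]
    ring
  have hk : ∀ k : Fin n,
      Integrable (fun z => Real.exp (-ψ z) * (frameInner (H z) (twistedCovDeriv H χ ψ a k z)
        (twistedCovDeriv H χ ψ a k z)).re) ∧
      Integrable (fun z => Real.exp (-ψ z) * (χ z ^ 2 *
        (frameInner (H z) ((curvMatrix H k k z).mulVec a) a).re)) ∧
      Integrable (fun z => Real.exp (-ψ z) * (‖dbarDeriv k (fun w => (χ w : ℂ)) z‖ ^ 2 *
        (frameInner (H z) a a).re)) ∧
      ∫ z, Real.exp (-ψ z) * (frameInner (H z) (twistedCovDeriv H χ ψ a k z)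
        (twistedCovDeriv H χ ψ a k z)).re =
      (∫ z, Real.exp (-ψ z) * (χ z ^ 2 *
        (frameInner (H z) ((curvMatrix H k k z).mulVec a) a).re)) +
      s * (∫ z, Real.exp (-ψ z) * (χ z ^ 2 * (frameInner (H z) a a).re)) +
      ∫ z, Real.exp (-ψ z) * (‖dbarDeriv k (fun w => (χ w : ℂ)) z‖ ^ 2 *
        (frameInner (H z) a a).re) := by
    intro k
    obtain ⟨h1, h2, h3, h4⟩ := integral_norm_twistedCovDeriv hU hH hdet hherm hχ hψ hc hχU k a
    have e1 : ∀ z, (Complex.exp (-ψ z) * frameInner (H z) (twistedCovDeriv H χ ψ a k z)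
        (twistedCovDeriv H χ ψ a k z)).re = Real.exp (-ψ z) * (frameInner (H z)
        (twistedCovDeriv H χ ψ a k z) (twistedCovDeriv H χ ψ a k z)).re := fun z => by
      rw [hexp, Complex.re_ofReal_mul]
    have e2 : ∀ z, ((χ z : ℂ) * (χ z * (Complex.exp (-ψ z) *
        (frameInner (H z) ((curvMatrix H k k z).mulVec a) a +
          dbarDeriv k (dDeriv k fun w => (ψ w : ℂ)) z * frameInner (H z) a a)))).re =
        Real.exp (-ψ z) * (χ z ^ 2 * (frameInner (H z) ((curvMatrix H k k z).mulVec a) a).re) +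
          s * (Real.exp (-ψ z) * (χ z ^ 2 * (frameInner (H z) a a).re)) := fun z => by
      simp only [hexp, hs, Complex.re_ofReal_mul, Complex.add_re]
      ring
    have e3 : ∀ z, (dbarDeriv k (fun w => (χ w : ℂ)) z * (dDeriv k (fun w => (χ w : ℂ)) z *
          (Complex.exp (-ψ z) * frameInner (H z) a a))).re =
        Real.exp (-ψ z) * (‖dbarDeriv k (fun w => (χ w : ℂ)) z‖ ^ 2 *
          (frameInner (H z) a a).re) := fun z => by
      have hd : dDeriv k (fun w => (χ w : ℂ)) z = conj (dbarDeriv k (fun w => (χ w : ℂ)) z) := by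
        rw [dDeriv_eq_wirtinger, dbarDeriv_eq_wirtinger,
          wirtinger_ofReal (hχ.differentiable (by simp) z)]
        simp
      rw [← mul_assoc, hd, Complex.mul_conj, hexp, Complex.re_ofReal_mul, Complex.re_ofReal_mul,
        Complex.normSq_eq_norm_sq]
      ring
    have j1 := h1.re
    have j2 := h2.re
    have j3 := h3.re
    simp only [RCLike.re_to_complex, e1, e2, e3] at j1 j2 j3
    have j4 : Integrable (fun z => Real.exp (-ψ z) * (χ z ^ 2 *
        (frameInner (H z) ((curvMatrix H k k z).mulVec a) a).re)) :=
      (j2.sub (iG.const_mul s)).congr (Filter.Eventually.of_forall fun z => by simp)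
    refine ⟨j1, j4, j3, ?_⟩
    have h5 := congrArg Complex.re h4
    rw [Complex.add_re] at h5
    have t1 := integral_re h1
    have t2 := integral_re h2
    have t3 := integral_re h3
    simp only [RCLike.re_to_complex, e1, e2, e3] at t1 t2 t3
    rw [← t1, ← t2, ← t3, integral_add j4 (iG.const_mul s), integral_const_mul] at h5
    exact h5
  simp only [Finset.mul_sum, Finset.sum_mul]
  refine ⟨integrable_finsetSum _ fun k _ => (hk k).1, integrable_finsetSum _ fun k _ => (hk k).2.1,
    iG, integrable_finsetSum _ fun k _ => (hk k).2.2.1, ?_⟩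
  rw [integral_finsetSum _ fun k _ => (hk k).1, integral_finsetSum _ fun k _ => (hk k).2.1,
    integral_finsetSum _ fun k _ => (hk k).2.2.1]
  simp only [(hk _).2.2.2, Finset.sum_add_distrib, Finset.sum_const, Finset.card_univ,
    Fintype.card_fin, nsmul_eq_mul]
  ring

end Integrated

/-! ### Covectors of top degree and quadratic weights -/

section TopForms

variable {n : ℕ}

lemma ext_apply (a : Cov n) (S T : Finset (Cov n)) :
    ext a S T = if a ∈ S ∧ T = S.erase a then (-1) ^ (T.filter fun b => b < a).card else 0 := by
  have h : (a ∉ T ∧ S = insert a T) ↔ (a ∈ S ∧ T = S.erase a) := by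
    constructor
    · rintro ⟨h, rfl⟩
      exact ⟨Finset.mem_insert_self _ _, (Finset.erase_insert h).symm⟩
    · rintro ⟨h, rfl⟩
      exact ⟨Finset.notMem_erase _ _, (Finset.insert_erase h).symm⟩
  simp only [ext, Matrix.of_apply, h]

/-- The only label of an `(n,n)`-covector, that of `dz_1 ∧ ⋯ ∧ dz_n ∧ dz̄_1 ∧ ⋯ ∧ dz̄_n`. -/
def topIdx (n : ℕ) : Idx n n n := ⟨Finset.univ, by simp, by simp⟩

lemma eq_topIdx (S : Idx n n n) : S = topIdx n := by
  obtain ⟨S, h1, h2⟩ := S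
  have h1' := Finset.card_eq_iff_eq_univ _ |>.1 (h1.trans (Fintype.card_fin n).symm)
  have h2' := Finset.card_eq_iff_eq_univ _ |>.1 (h2.trans (Fintype.card_fin n).symm)
  refine Subtype.ext (Finset.eq_univ_iff_forall.2 fun a => ?_)
  rcases a with j | k
  · have h := Finset.mem_univ j
    rw [← h1', Finset.mem_filter] at h
    exact h.2
  · have h := Finset.mem_univ k
    rw [← h2', Finset.mem_filter] at h
    exact h.2

instance : Unique (Idx n n n) := ⟨⟨topIdx n⟩, eq_topIdx⟩

/-- The label of the `(n,n-1)`-covector in which `dz̄_k` is missing. -/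
def omitIdx (k : Fin n) : Idx n n (n - 1) :=
  ⟨Finset.univ.erase (dzbar k), by simp, by
    rw [show (Finset.univ.filter fun l : Fin n => dzbar l ∈ Finset.univ.erase (dzbar k))
      = Finset.univ.erase k by ext l; simp [dzbar]]
    simp⟩

lemma omitIdx_injective : Function.Injective (omitIdx (n := n)) := by
  intro k l h
  have h1 : (Finset.univ.erase (dzbar k) : Finset (Cov n)) = Finset.univ.erase (dzbar l) :=
    congrArg Subtype.val h
  have h2 : dzbar k ∉ (Finset.univ.erase (dzbar l) : Finset (Cov n)) := by simp [← h1]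
  simpa [dzbar] using h2

/-- The sign in `dz̄_k ∧ e = ± dz_1 ∧ ⋯ ∧ dz̄_n`, where `e` is the basis covector labelled by
`omitIdx k`. -/
noncomputable def omitSign (k : Fin n) : ℂ :=
  (-1) ^ ((Finset.univ.erase (dzbar k)).filter fun b => b < dzbar k).card

lemma norm_omitSign (k : Fin n) : ‖omitSign k‖ = 1 := by simp [omitSign]

lemma tensorId_ext_dzbar {V : Type*} [AddCommGroup V] [Module ℂ V] (k : Fin n)
    (u : Form n n (n - 1) V) :
    tensorId ((ext (dzbar k)).submatrix Subtype.val Subtype.val) u (topIdx n) =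
      omitSign k • u (omitIdx k) := by
  simp only [tensorId, Matrix.submatrix_apply]
  rw [Finset.sum_eq_single (omitIdx k)]
  · simp [ext_apply, omitIdx, topIdx, omitSign]
  · intro T _ hT
    have : (T : Finset (Cov n)) ≠ Finset.univ.erase (dzbar k) := fun h => hT (Subtype.ext h)
    simp [ext_apply, topIdx, this]
  · simp

lemma wedge11_smul (s : ℂ) (A : Matrix (Fin n) (Fin n) ℂ) : wedge11 (s • A) = s • wedge11 A := by
  simp only [wedge11, Finset.smul_sum, smul_smul, Matrix.smul_apply, smul_eq_mul]
  exact Finset.sum_congr rfl fun j _ => Finset.sum_congr rfl fun k _ => by congr 1; ring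

lemma Lom_eq : Lom n = ∑ j, Complex.I • (ext (dz j) * ext (dzbar j)) := by
  simp only [Lom, wedge11]
  refine Finset.sum_congr rfl fun j _ => ?_
  rw [Finset.sum_eq_single j]
  · simp
  · intro k _ hk
    simp [Matrix.one_apply_ne hk.symm]
  · simp

lemma Lom_apply_univ (S : Finset (Cov n)) : Lom n S Finset.univ = 0 := by
  simp [Lom_eq, Matrix.sum_apply, Matrix.mul_apply, ext]

/-- The square of the norm of the row of `L_ω` that belongs to the top degree: the nonzero
entries `± i` are at the `n` sets of labels in which a pair `dz_j, dz̄_j` is missing. -/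
lemma sum_Lom_univ_mul_conj :
    ∑ T, Lom n Finset.univ T * conj (Lom n Finset.univ T) = n := by
  let τ : Fin n → Finset (Cov n) := fun j => (Finset.univ.erase (dz j)).erase (dzbar j)
  have hτ : Function.Injective τ := by
    intro j k h
    have h1 : dz j ∉ τ k := by rw [← h]; simp [τ]
    simpa [τ, dz, dzbar] using h1
  have hc : ∀ j : Fin n, ∃ η : ℂ, η * conj η = 1 ∧ ∀ T : Finset (Cov n),
      (Complex.I • (ext (dz j) * ext (dzbar j))) Finset.univ T = if T = τ j then η else 0 := by
    intro j
    refine ⟨Complex.I * ((-1) ^ ((Finset.univ.erase (dz j)).filter fun b => b < dz j).card *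
      (-1) ^ ((τ j).filter fun b => b < dzbar j).card), ?_, fun T => ?_⟩
    · rw [Complex.mul_conj, Complex.normSq_eq_norm_sq]
      simp
    · rw [Matrix.smul_apply, Matrix.mul_apply, Finset.sum_eq_single (Finset.univ.erase (dz j))]
      · rw [ext_apply, ext_apply]
        by_cases h : T = τ j
        · subst h
          simp [τ, dz, dzbar]
        · have h' : T ≠ (Finset.univ.erase (dz j)).erase (dzbar j) := h
          simp [h, h']
      · intro S _ hS
        simp [ext_apply, hS]
      · simp
  choose η h1 h2 using hc
  have h3 : ∀ T : Finset (Cov n), Lom n Finset.univ T = ∑ j, if T = τ j then η j else 0 := by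
    intro T
    rw [Lom_eq, Matrix.sum_apply]
    exact Finset.sum_congr rfl fun j _ => h2 j T
  have h4 : ∀ T : Finset (Cov n), Lom n Finset.univ T * conj (Lom n Finset.univ T) =
      ∑ j, if T = τ j then (1 : ℂ) else 0 := by
    intro T
    rw [h3]
    by_cases h : ∃ j, T = τ j
    · obtain ⟨j, rfl⟩ := h
      simp [hτ.eq_iff, h1]
    · push Not at h
      simp [h]
  simp only [h4]
  rw [Finset.sum_comm]
  simp

/-- On `(n,n)`-forms, `[i∂∂̄ψ, Λ_ω]` is multiplication by the trace of the complex Hessian; this is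
the case of a Hessian that is a multiple of the identity. -/
lemma twistedOp_apply_univ {ψ : Cn n → ℝ} {z : Cn n} {s : ℝ} (c : ℝ)
    (h : levi ψ z = (s : ℂ) • (1 : Matrix (Fin n) (Fin n) ℂ)) :
    twistedOp ψ c z Finset.univ Finset.univ = ((n * s + c : ℝ) : ℂ) := by
  have h1 : (Lom n * Lam n) Finset.univ Finset.univ = n := by
    rw [Matrix.mul_apply, ← sum_Lom_univ_mul_conj]
    rfl
  have h2 : (Lam n * Lom n) Finset.univ Finset.univ = 0 := by
    simp [Matrix.mul_apply, Lom_apply_univ]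
  rw [twistedOp, h, wedge11_smul, ← Lom, Matrix.smul_mul, Matrix.mul_smul, Matrix.add_apply,
    Matrix.sub_apply, Matrix.smul_apply, Matrix.smul_apply, Matrix.smul_apply, h1, h2]
  simp
  ring

lemma tensorId_twistedOpInv {V : Type*} [AddCommGroup V] [Module ℂ V] {ψ : Cn n → ℝ} {z : Cn n}
    {s : ℝ} (c : ℝ) (h : levi ψ z = (s : ℂ) • (1 : Matrix (Fin n) (Fin n) ℂ))
    (f : Form n n n V) :
    tensorId (twistedOpInv n n ψ c z) f = ((n * s + c : ℝ) : ℂ)⁻¹ • f := by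
  funext S
  obtain rfl := eq_topIdx S
  have h1 := twistedOp_apply_univ c h
  rw [tensorId, Fintype.sum_unique, twistedOpInv, Matrix.inv_subsingleton]
  change (Matrix.diagonal fun i => _) (topIdx n) (topIdx n) • f (topIdx n) = _
  rw [Matrix.diagonal_apply_eq, Matrix.submatrix_apply]
  change Ring.inverse (twistedOp ψ c z Finset.univ Finset.univ) • _ = _
  rw [h1, Ring.inverse_eq_inv']
  rfl

lemma contDiff_quadratic (s : ℝ) (p : Cn n) :
    ContDiff ℝ ∞ (fun w : Cn n => s * ‖w - p‖ ^ 2) :=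
  contDiff_const.mul ((contDiff_id.sub contDiff_const).norm_sq ℝ)

lemma levi_quadratic (s : ℝ) (p z : Cn n) :
    levi (fun w => s * ‖w - p‖ ^ 2) z = (s : ℂ) • (1 : Matrix (Fin n) (Fin n) ℂ) := by
  ext j k
  have h1 : dbarDeriv k (fun w => ((s * ‖w - p‖ ^ 2 : ℝ) : ℂ)) =
      fun w : Cn n => (s : ℂ) * (w k - p k) := by
    funext w
    rw [dbarDeriv_eq_wirtinger, wirtinger_normSq, mul_comm Complex.I, Complex.re_add_im]
  have h2 : HasFDerivAt (fun w : Cn n => (s : ℂ) * (w k - p k))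
      ((s : ℂ) • (EuclideanSpace.proj (𝕜 := ℂ) k : Cn n →L[ℂ] ℂ).restrictScalars ℝ) z :=
    ((((EuclideanSpace.proj (𝕜 := ℂ) k : Cn n →L[ℂ] ℂ).restrictScalars ℝ).hasFDerivAt).sub_const
      (p k)).const_mul (s : ℂ)
  rw [levi, Matrix.of_apply, h1, dDeriv, h2.fderiv]
  by_cases h : j = k
  · subst h
    simp
    ring_nf
    simp
    ring
  · simp [Matrix.one_apply_ne h, Ne.symm h]

lemma isSmoothStrictlyPsh_quadratic (D : TopologicalSpace.Opens (Cn n)) {s : ℝ} (hs : 0 < s)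
    (p : Cn n) : IsSmoothStrictlyPsh D (fun w => s * ‖w - p‖ ^ 2) := by
  refine ⟨(contDiff_quadratic s p).contDiffOn, fun z _ => ?_⟩
  rw [levi_quadratic]
  exact Matrix.PosDef.one.smul (by exact_mod_cast hs)

lemma dbarDeriv_dDeriv_quadratic (s : ℝ) (p : Cn n) (k : Fin n) (z : Cn n) :
    dbarDeriv k (dDeriv k fun w => ((s * ‖w - p‖ ^ 2 : ℝ) : ℂ)) z = s := by
  have h := congrFun (congrFun (levi_quadratic s p z) k) k
  have hc : ContDiff ℝ ∞ (fun w : Cn n => ((s * ‖w - p‖ ^ 2 : ℝ) : ℂ)) :=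
    Complex.ofRealCLM.contDiff.comp (contDiff_quadratic s p)
  rw [dbarDeriv_eq_wirtinger, dDeriv_eq_wirtinger, wirtinger_comm hc, ← dbarDeriv_eq_wirtinger,
    ← dDeriv_eq_wirtinger]
  simpa [levi] using h

end TopForms

/-! ### Concentration of the weights -/

section Concentration

variable {n r : ℕ}

/-- As `s → ∞` the weights `exp (-s |z - p|²)` concentrate at `p`: a function that is negative near
`p` cannot be compensated by a bounded one that vanishes there. -/
lemma exists_integral_add_integral_neg {f g : Cn n → ℝ} {p : Cn n} {δ C r₁ r₂ R : ℝ}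
    (hδ : 0 < δ) (hr₁ : 0 < r₁) (hr : r₁ < r₂)
    (hf : ∀ z, f z ≤ 0) (hf₁ : ∀ z ∈ Metric.closedBall p r₁, f z ≤ -δ)
    (hC : 0 ≤ C) (hg : ∀ z, g z ≤ C) (hg₂ : ∀ z ∈ Metric.ball p r₂, g z = 0)
    (hgR : ∀ z ∉ Metric.closedBall p R, g z = 0)
    (hfi : ∀ s : ℝ, 0 < s → Integrable fun z => Real.exp (-(s * ‖z - p‖ ^ 2)) * f z)
    (hgi : ∀ s : ℝ, 0 < s → Integrable fun z => Real.exp (-(s * ‖z - p‖ ^ 2)) * g z) :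
    ∃ s : ℝ, 0 < s ∧ (∫ z, Real.exp (-(s * ‖z - p‖ ^ 2)) * f z) +
      ∫ z, Real.exp (-(s * ‖z - p‖ ^ 2)) * g z < 0 := by
  by_contra! hcon
  set V₁ := volume.real (Metric.closedBall p r₁) with hV₁
  set V := volume.real (Metric.closedBall p R) with hV
  have hV₁pos : 0 < V₁ :=
    ENNReal.toReal_pos (Metric.measure_closedBall_pos _ _ hr₁).ne' measure_closedBall_lt_top.ne
  have hint : ∀ (ρ a : ℝ), Integrable ((Metric.closedBall p ρ).indicator fun _ : Cn n => a) :=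
    fun ρ a => (integrable_indicator_iff Metric.isClosed_closedBall.measurableSet).2
      (integrableOn_const measure_closedBall_lt_top.ne)
  have hval : ∀ (ρ a : ℝ), ∫ z, (Metric.closedBall p ρ).indicator (fun _ : Cn n => a) z =
      volume.real (Metric.closedBall p ρ) * a := fun ρ a => by
    rw [integral_indicator Metric.isClosed_closedBall.measurableSet, setIntegral_const, smul_eq_mul]
  have hmain : ∀ s : ℝ, 0 < s → δ * V₁ ≤ C * V * Real.exp (-(s * (r₂ ^ 2 - r₁ ^ 2))) := by
    intro s hs
    have h1 : ∫ z, Real.exp (-(s * ‖z - p‖ ^ 2)) * f z ≤ V₁ * (-δ * Real.exp (-(s * r₁ ^ 2))) := by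
      rw [← hval]
      refine integral_mono (hfi s hs) (hint _ _) fun z => ?_
      by_cases hz : z ∈ Metric.closedBall p r₁
      · have hz' : ‖z - p‖ ≤ r₁ := by simpa [dist_eq_norm] using hz
        have he : Real.exp (-(s * r₁ ^ 2)) ≤ Real.exp (-(s * ‖z - p‖ ^ 2)) := by gcongr
        have hfz := hf₁ z hz
        simp only [Set.indicator_of_mem hz]
        nlinarith [Real.exp_pos (-(s * r₁ ^ 2)), Real.exp_pos (-(s * ‖z - p‖ ^ 2))]
      · simp only [Set.indicator_of_notMem hz]
        exact mul_nonpos_of_nonneg_of_nonpos (Real.exp_pos _).le (hf z)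
    have h2 : ∫ z, Real.exp (-(s * ‖z - p‖ ^ 2)) * g z ≤ V * (C * Real.exp (-(s * r₂ ^ 2))) := by
      rw [← hval]
      refine integral_mono (hgi s hs) (hint _ _) fun z => ?_
      by_cases hz : z ∈ Metric.closedBall p R
      · simp only [Set.indicator_of_mem hz]
        by_cases hz2 : z ∈ Metric.ball p r₂
        · rw [hg₂ z hz2, mul_zero]
          positivity
        · have hz' : r₂ ≤ ‖z - p‖ := by simpa [dist_eq_norm] using hz2
          have h0 : 0 ≤ r₂ := (hr₁.trans hr).le
          have he : Real.exp (-(s * ‖z - p‖ ^ 2)) ≤ Real.exp (-(s * r₂ ^ 2)) := by gcongr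
          calc Real.exp (-(s * ‖z - p‖ ^ 2)) * g z ≤ Real.exp (-(s * ‖z - p‖ ^ 2)) * C := by
                gcongr; exact hg z
            _ ≤ Real.exp (-(s * r₂ ^ 2)) * C := by gcongr
            _ = _ := mul_comm _ _
      · simp [Set.indicator_of_notMem hz, hgR z hz]
    have h3 := hcon s hs
    have h4 : Real.exp (-(s * r₂ ^ 2)) =
        Real.exp (-(s * (r₂ ^ 2 - r₁ ^ 2))) * Real.exp (-(s * r₁ ^ 2)) := by
      rw [← Real.exp_add]; ring_nf
    rw [h4] at h2
    have h5 : δ * V₁ * Real.exp (-(s * r₁ ^ 2)) ≤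
        C * V * Real.exp (-(s * (r₂ ^ 2 - r₁ ^ 2))) * Real.exp (-(s * r₁ ^ 2)) := by linarith
    exact le_of_mul_le_mul_right h5 (Real.exp_pos _)
  have hpos : 0 < r₂ ^ 2 - r₁ ^ 2 := by nlinarith
  have hlim : Filter.Tendsto (fun s : ℝ => C * V * Real.exp (-(s * (r₂ ^ 2 - r₁ ^ 2))))
      Filter.atTop (nhds (C * V * 0)) :=
    (Real.tendsto_exp_neg_atTop_nhds_zero.comp
      (Filter.tendsto_id.atTop_mul_const hpos)).const_mul _
  have := ge_of_tendsto hlim (Filter.eventually_atTop.2 ⟨1, fun s hs => hmain s (by linarith)⟩)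
  rw [mul_zero] at this
  exact absurd (mul_pos hδ hV₁pos) this.not_gt

/-- The estimate `∫ (Δψ + c) |χ a|² e^{-ψ} ≤ ∑_k ∫ |∇_k (χ a)|² e^{-ψ}` for all cut-off functions
`χ` and all quadratic weights centred at `p` bounds the trace of the curvature at `p` from below. -/
lemma le_trace_curvMatrix_of_estimate {U : Set (Cn n)} {H : Cn n → Matrix (Fin r) (Fin r) ℂ}
    (hU : IsOpen U) (hH : ∀ α β, ContDiffOn ℝ ∞ (fun z => H z α β) U)
    (hdet : ∀ z ∈ U, (H z).det ≠ 0) (hherm : ∀ z ∈ U, ∀ α β, H z β α = conj (H z α β))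
    {p : Cn n} (hp : p ∈ U) (a : Fin r → ℂ) (c : ℝ)
    (hest : ∀ χ : Cn n → ℝ, ContDiff ℝ ∞ χ → HasCompactSupport χ → tsupport χ ⊆ U →
      ∀ s : ℝ, 0 < s →
        (n * s + c) * (∫ z, Real.exp (-(s * ‖z - p‖ ^ 2)) *
            (χ z ^ 2 * (frameInner (H z) a a).re)) ≤
          ∫ z, Real.exp (-(s * ‖z - p‖ ^ 2)) *
            ∑ k, (frameInner (H z) (twistedCovDeriv H χ (fun w => s * ‖w - p‖ ^ 2) a k z)
              (twistedCovDeriv H χ (fun w => s * ‖w - p‖ ^ 2) a k z)).re) :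
    c * (frameInner (H p) a a).re ≤
      ∑ k, (frameInner (H p) ((curvMatrix H k k p).mulVec a) a).re := by
  set G : Cn n → ℝ := fun z => (frameInner (H z) a a).re with hGdef
  set T : Cn n → ℝ := fun z => ∑ k, (frameInner (H z) ((curvMatrix H k k z).mulVec a) a).re
    with hTdef
  have hGc : ContinuousOn G U := Complex.continuous_re.comp_continuousOn
    (contDiffOn_frameInner (v := fun _ => a) (w := fun _ => a) hH (fun _ => contDiffOn_const)
      (fun _ => contDiffOn_const)).continuousOn
  have hTc : ContinuousOn T U := by
    refine continuousOn_finsetSum _ fun k _ => Complex.continuous_re.comp_continuousOn ?_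
    refine (contDiffOn_frameInner (v := fun z => (curvMatrix H k k z).mulVec a)
      (w := fun _ => a) hH (fun α => ?_) (fun _ => contDiffOn_const)).continuousOn
    simp only [Matrix.mulVec, dotProduct]
    exact ContDiffOn.sum fun γ _ =>
      (contDiffOn_curvMatrix hU hH hdet k k α γ).mul contDiffOn_const
  by_contra! hlt
  change T p < c * G p at hlt
  set δ := (c * G p - T p) / 2 with hδdef
  have hδ : 0 < δ := by simp only [hδdef]; linarith
  have hev : ∀ᶠ z in nhds p, z ∈ U ∧ T z - c * G z < -δ := by
    refine Filter.Eventually.and (hU.mem_nhds hp) ?_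
    have hcont : ContinuousAt (fun z => T z - c * G z) p :=
      ((hTc.sub (hGc.const_smul c)).continuousAt (hU.mem_nhds hp))
    exact hcont.eventually (gt_mem_nhds (by simp only [hδdef]; linarith))
  obtain ⟨R, hR, hball⟩ := Metric.nhds_basis_closedBall.eventually_iff.1 hev
  -- `χ = 1` on the ball of radius `R / 2`, so its derivatives vanish there
  let χ : ContDiffBump p := ⟨R / 2, R, by linarith, by linarith⟩
  have hχ : ContDiff ℝ ∞ χ := χ.contDiff
  have hχt : tsupport χ = Metric.closedBall p R := χ.tsupport_eq
  have hχc : HasCompactSupport χ := χ.hasCompactSupport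
  have hχU : tsupport χ ⊆ U := by rw [hχt]; exact fun z hz => (hball hz).1
  have hψ : ∀ s : ℝ, ContDiff ℝ ∞ (fun w : Cn n => s * ‖w - p‖ ^ 2) := fun s =>
    contDiff_quadratic s p
  set N : Cn n → ℝ := fun z => ∑ k, ‖dbarDeriv k (fun w => (χ w : ℂ)) z‖ ^ 2 with hNdef
  have hN0 : ∀ z, z ∉ Metric.closedBall p R → N z = 0 := by
    intro z hz
    refine Finset.sum_eq_zero fun k _ => ?_
    rw [dbarDeriv_eq_wirtinger, wirtinger_eq_zero_of_notMem_tsupport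
      (by rwa [tsupport_ofReal, hχt])]
    simp
  have hN1 : ∀ z ∈ Metric.ball p (R / 2), N z = 0 := by
    intro z hz
    refine Finset.sum_eq_zero fun k _ => ?_
    have h1 : (fun w => (χ w : ℂ)) =ᶠ[nhds z] fun _ => 1 := by
      filter_upwards [Metric.isOpen_ball.mem_nhds hz] with w hw
      rw [χ.one_of_mem_closedBall (Metric.ball_subset_closedBall hw)]
      simp
    rw [dbarDeriv_eq_wirtinger, wirtinger_congr h1]
    simp [wirtinger]
  have hNc : Continuous N := by
    refine continuous_finsetSum _ fun k _ => ?_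
    rw [dbarDeriv_eq_wirtinger]
    exact ((contDiff_wirtinger (Complex.ofRealCLM.contDiff.comp hχ)).continuous.norm).pow 2
  obtain ⟨C, hC⟩ := (isCompact_closedBall p R).exists_bound_of_continuousOn
    (f := fun z => N z * G z) (hNc.continuousOn.mul (hGc.mono fun z hz => (hball hz).1))
  have hC0 : 0 ≤ C := (norm_nonneg _).trans (hC p (Metric.mem_closedBall_self hR.le))
  have hB := fun s : ℝ => bochner_kodaira hU hH hdet hherm hχ (hψ s) hχc hχU a s
    (fun k z => dbarDeriv_dDeriv_quadratic s p k z)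
  have hfeq : ∀ (s : ℝ) (z : Cn n), Real.exp (-(s * ‖z - p‖ ^ 2)) * (χ z ^ 2 * (T z - c * G z)) =
      Real.exp (-(s * ‖z - p‖ ^ 2)) * (χ z ^ 2 * T z) -
        c * (Real.exp (-(s * ‖z - p‖ ^ 2)) * (χ z ^ 2 * G z)) := fun s z => by ring
  obtain ⟨s, hs, hneg⟩ := exists_integral_add_integral_neg (p := p) (δ := δ) (C := C) (r₁ := R / 4)
    (r₂ := R / 2) (R := R) (f := fun z => χ z ^ 2 * (T z - c * G z)) (g := fun z => N z * G z)
    hδ (by linarith) (by linarith)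
    (fun z => by
      by_cases hz : z ∈ Metric.closedBall p R
      · exact mul_nonpos_of_nonneg_of_nonpos (sq_nonneg _) (by linarith [(hball hz).2])
      · rw [image_eq_zero_of_notMem_tsupport (f := χ) (by rwa [hχt])]
        simp)
    (fun z hz => by
      rw [χ.one_of_mem_closedBall (Metric.closedBall_subset_closedBall (by
        change R / 4 ≤ R / 2; linarith) hz)]
      linarith [(hball (Metric.closedBall_subset_closedBall (by linarith) hz)).2])
    hC0
    (fun z => by
      by_cases hz : z ∈ Metric.closedBall p R
      · exact (le_abs_self _).trans (hC z hz)
      · simpa [hN0 z hz] using hC0)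
    (fun z hz => by simp [hN1 z hz]) (fun z hz => by simp [hN0 z hz])
    (fun s _ => by
      simp only [hfeq]
      exact (hB s).2.1.sub ((hB s).2.2.1.const_mul c))
    (fun s _ => (hB s).2.2.2.1)
  have h1 := hest χ hχ hχc hχU s hs
  rw [(hB s).2.2.2.2] at h1
  simp only [hfeq] at hneg
  rw [integral_sub (hB s).2.1 ((hB s).2.2.1.const_mul c), integral_const_mul] at hneg
  linarith

end Concentration

/-! ### Integrals, test forms and metrics on the bundle -/

section Volume

variable {n : ℕ} {D : TopologicalSpace.Opens (Cn n)}

lemma zeroExt_coe {W : Type*} [Zero W] (g : D → W) (x : D) : zeroExt g x = g x :=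
  Subtype.val_injective.extend_apply _ _ _

lemma integral_dVol {W : Type*} [NormedAddCommGroup W] [NormedSpace ℝ W] (F : Cn n → W)
    (hF : ∀ z, z ∉ D → F z = 0) :
    ∫ x : D, F x ∂(dVol D) = (2 ^ n : ℝ) • ∫ z, F z := by
  rw [dVol, integral_smul_measure]
  erw [integral_subtype_comap D.isOpen.measurableSet F]
  rw [setIntegral_eq_integral_of_forall_compl_eq_zero (fun z hz => hF z hz)]
  simp

lemma integrable_dVol {W : Type*} [NormedAddCommGroup W] {F : Cn n → W} (hF : Integrable F) :
    Integrable (fun x : D => F x) (dVol D) := by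
  refine Integrable.smul_measure ?_ (by simp)
  have hm : MeasurableEmbedding (Subtype.val : D → Cn n) :=
    MeasurableEmbedding.subtype_coe D.isOpen.measurableSet
  have h : Integrable F
      (Measure.map (Subtype.val : D → Cn n) (Measure.comap Subtype.val volume)) := by
    rw [hm.map_comap]
    exact hF.restrict
  exact hm.integrable_map_iff.1 h

lemma isCompact_preimage_coe {K : Set (Cn n)} (hK : IsCompact K) (hKD : K ⊆ D) :
    IsCompact (Subtype.val ⁻¹' K : Set D) :=
  Topology.IsInducing.subtypeVal.isCompact_preimage_iff (by simpa using hKD) |>.2 hK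

end Volume

section Bundle

variable {n r : ℕ} {D : TopologicalSpace.Opens (Cn n)} {E : D → Type*}
  [∀ x, AddCommGroup (E x)] [∀ x, Module ℂ (E x)] [∀ x, TopologicalSpace (E x)]
  [TopologicalSpace (TotalSpace (Fin r → ℂ) E)] [FiberBundle (Fin r → ℂ) E]
  [VectorBundle ℂ (Fin r → ℂ) E]

omit [∀ x, AddCommGroup (E x)] [∀ x, Module ℂ (E x)] [∀ x, TopologicalSpace (E x)]
  [FiberBundle (Fin r → ℂ) E] [VectorBundle ℂ (Fin r → ℂ) E] in
lemma isOpen_image_baseSet (e : Trivialization (Fin r → ℂ) (π (Fin r → ℂ) E)) :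
    IsOpen (Subtype.val '' e.baseSet : Set (Cn n)) :=
  D.isOpen.isOpenMap_subtype_val _ e.open_baseSet

/-- Holomorphic transition functions are smooth. -/
lemma contDiffOn_transition [ContMDiffVectorBundle ω (Fin r → ℂ) E 𝓘(ℂ, Cn n)]
    (e e' : Trivialization (Fin r → ℂ) (π (Fin r → ℂ) E)) [MemTrivializationAtlas e]
    [MemTrivializationAtlas e'] (a : Fin r → ℂ) :
    ContDiffOn ℝ ∞ (zeroExt fun x : D => e'.linearMapAt ℂ x (e.symmₗ ℂ x a))
      (Subtype.val '' (e.baseSet ∩ e'.baseSet)) := by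
  rintro _ ⟨x, hx, rfl⟩
  have h1 : ContMDiffAt 𝓘(ℂ, Cn n) 𝓘(ℂ, (Fin r → ℂ) →L[ℂ] (Fin r → ℂ)) ω
      (fun b : D => (e.coordChangeL ℂ e' b : (Fin r → ℂ) →L[ℂ] (Fin r → ℂ))) x :=
    contMDiffAt_coordChangeL hx.1 hx.2
  have h2 : ContMDiffAt 𝓘(ℂ, Cn n) 𝓘(ℂ, Fin r → ℂ) ω
      (fun b : D => (e.coordChangeL ℂ e' b : (Fin r → ℂ) →L[ℂ] (Fin r → ℂ)) a) x :=
    h1.clm_apply contMDiffAt_const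
  have h3 : ContMDiffAt 𝓘(ℂ, Cn n) 𝓘(ℂ, Fin r → ℂ) ω
      (fun b : D => e'.linearMapAt ℂ b (e.symmₗ ℂ b a)) x := by
    refine h2.congr_of_eventuallyEq ?_
    filter_upwards [(e.open_baseSet.inter e'.open_baseSet).mem_nhds hx] with b hb
    rw [e.symmₗ_apply hb.1, e'.coe_linearMapAt_of_mem hb.2]
    exact (e.coordChangeL_apply e' hb a).symm
  have h4 : ContMDiffAt 𝓘(ℂ, Cn n) 𝓘(ℂ, Fin r → ℂ) ω
      (zeroExt fun b : D => e'.linearMapAt ℂ b (e.symmₗ ℂ b a)) (x : Cn n) := by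
    rw [← contMDiffAt_subtype_iff]
    simpa only [zeroExt_coe] using h3
  exact ((h4.contDiffAt.restrict_scalars ℝ).of_le le_top).contDiffWithinAt

/-- A constant vector of a holomorphic frame, cut off inside the domain of the frame, gives a test
form. -/
lemma isTestForm_cutoff [ContMDiffVectorBundle ω (Fin r → ℂ) E 𝓘(ℂ, Cn n)]
    (e : Trivialization (Fin r → ℂ) (π (Fin r → ℂ) E)) [MemTrivializationAtlas e]
    (a : Fin r → ℂ) {χ : Cn n → ℂ} (hχ : ContDiff ℝ ∞ χ) (hc : HasCompactSupport χ)
    (hχU : tsupport χ ⊆ Subtype.val '' e.baseSet) {p q : ℕ} :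
    IsTestForm (p := p) (q := q) r (E := E) (fun x _ => χ x • e.symmₗ ℂ x a) := by
  have hD : tsupport χ ⊆ (D : Set (Cn n)) := hχU.trans (by rintro _ ⟨x, _, rfl⟩; exact x.2)
  refine ⟨fun _ e' _ => ?_, Subtype.val ⁻¹' tsupport χ, isCompact_preimage_coe hc hD,
    fun x hx => ?_⟩
  · rintro _ ⟨x, hx, rfl⟩
    refine ContDiffAt.contDiffWithinAt ?_
    have hD' := D.isOpen.mem_nhds x.2
    by_cases hxs : (x : Cn n) ∈ tsupport χ
    · obtain ⟨y, hy, hyx⟩ := hχU hxs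
      obtain rfl := Subtype.val_injective hyx
      have hmem : (y : Cn n) ∈ Subtype.val '' (e.baseSet ∩ e'.baseSet) := ⟨y, ⟨hy, hx⟩, rfl⟩
      have hopen : IsOpen (Subtype.val '' (e.baseSet ∩ e'.baseSet) : Set (Cn n)) :=
        D.isOpen.isOpenMap_subtype_val _ (e.open_baseSet.inter e'.open_baseSet)
      have h := hχ.contDiffAt.smul
        ((contDiffOn_transition e e' a).contDiffAt (hopen.mem_nhds hmem))
      refine h.congr_of_eventuallyEq ?_
      filter_upwards [hD'] with z hz
      have h1 := zeroExt_coe (fun x : D => e'.linearMapAt ℂ x (χ x • e.symmₗ ℂ x a)) ⟨z, hz⟩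
      have h2 := zeroExt_coe (fun x : D => e'.linearMapAt ℂ x (e.symmₗ ℂ x a)) ⟨z, hz⟩
      simp only at h1 h2
      rw [Pi.smul_apply', h1, h2, map_smul]
    · refine (contDiffAt_const (c := (0 : Fin r → ℂ))).congr_of_eventuallyEq ?_
      filter_upwards [hD', notMem_tsupport_iff_eventuallyEq.1 hxs] with z hz hz0
      have h1 := zeroExt_coe (fun x : D => e'.linearMapAt ℂ x (χ x • e.symmₗ ℂ x a)) ⟨z, hz⟩
      simp only at h1
      rw [h1, hz0]
      simp
  · funext _
    have : χ x = 0 := image_eq_zero_of_notMem_tsupport hx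
    simp [this]

namespace HermitianMetric

variable (h : HermitianMetric r E)

lemma inner_self_re_nonneg (x : D) (v : E x) : 0 ≤ (h.inner x v v).re := by
  by_cases hv : v = 0
  · simp [hv]
  · exact (h.pos x v hv).le

lemma norm_inner_le (x : D) (v w : E x) :
    ‖h.inner x v w‖ ≤ ((h.inner x v v).re + (h.inner x w w).re) / 2 := by
  -- positivity of `|c v - w|²`, where the phase `c` makes `(c v, w)` real and nonnegative
  obtain ⟨c, hc, hcv⟩ : ∃ c : ℂ, ‖c‖ = 1 ∧ c * h.inner x v w = ‖h.inner x v w‖ := by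
    obtain ⟨c, hc, h⟩ := RCLike.exists_norm_eq_mul_self (h.inner x v w)
    exact ⟨c, hc, by simpa using h.symm⟩
  have h1 := h.inner_self_re_nonneg x (c • v - w)
  have h2 : h.inner x (c • v - w) (c • v - w) = (c * conj c) * h.inner x v v
      - c * h.inner x v w - conj (c * h.inner x v w) + h.inner x w w := by
    simp only [map_sub, LinearMap.sub_apply, map_smul, LinearMap.smul_apply, smul_eq_mul,
      LinearMap.map_smulₛₗ, map_mul, ← h.conj_symm x v w]
    ring
  rw [h2, hcv, Complex.mul_conj, Complex.normSq_eq_norm_sq, hc, Complex.conj_ofReal] at h1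
  simp at h1
  linarith

variable (e : Trivialization (Fin r → ℂ) (π (Fin r → ℂ) E)) [MemTrivializationAtlas e]

lemma frameInner_gram {x : D} (hx : x ∈ e.baseSet) (v w : Fin r → ℂ) :
    frameInner (h.gram e x) v w = h.inner x (e.symmₗ ℂ x v) (e.symmₗ ℂ x w) := by
  have hs : ∀ v : Fin r → ℂ, e.symmₗ ℂ x v = ∑ α, v α • e.symmₗ ℂ x (Pi.single α 1) := by
    intro v
    conv_lhs => rw [← Finset.univ_sum_single v]
    rw [map_sum]
    refine Finset.sum_congr rfl fun α _ => ?_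
    rw [← map_smul]
    congr 1
    rw [← Pi.single_smul]
    simp
  rw [hs v, hs w]
  simp only [frameInner, gram, Matrix.of_apply, zeroExt_coe, map_sum, LinearMap.sum_apply,
    LinearMap.map_smulₛₗ, map_smul, LinearMap.smul_apply, smul_eq_mul, ← e.symmₗ_apply (R := ℂ) hx,
    Finset.mul_sum]
  exact Finset.sum_comm.trans (Finset.sum_congr rfl fun β _ =>
    Finset.sum_congr rfl fun α _ => by ring)

lemma contDiffOn_gram (α β : Fin r) :
    ContDiffOn ℝ ∞ (fun z => h.gram e z α β) (Subtype.val '' e.baseSet) :=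
  h.smooth e (Pi.single α 1) (Pi.single β 1)

omit [MemTrivializationAtlas e] in
lemma gram_conj {z : Cn n} (hz : z ∈ Subtype.val '' e.baseSet) (α β : Fin r) :
    h.gram e z β α = conj (h.gram e z α β) := by
  obtain ⟨x, _, rfl⟩ := hz
  simp only [gram, Matrix.of_apply, zeroExt_coe]
  exact h.conj_symm _ _ _

lemma det_gram_ne_zero {z : Cn n} (hz : z ∈ Subtype.val '' e.baseSet) : (h.gram e z).det ≠ 0 := by
  obtain ⟨x, hx, rfl⟩ := hz
  intro hdet
  obtain ⟨v, hv, hv0⟩ := Matrix.exists_vecMul_eq_zero_iff.2 hdet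
  have h1 : frameInner (h.gram e x) v v = 0 := by
    have h2 : ∀ β, ∑ α, v α * h.gram e x α β = 0 := fun β => congrFun hv0 β
    rw [frameInner, Finset.sum_comm]
    simp only [← Finset.sum_mul, h2, zero_mul, Finset.sum_const_zero]
  rw [h.frameInner_gram e hx] at h1
  have h3 : e.symmₗ ℂ x v ≠ 0 := by
    intro h0
    apply hv
    rw [← e.linearMapAt_symmₗ (R := ℂ) hx v, h0, map_zero]
  have h4 := h.pos x _ h3
  rw [h1] at h4
  simp at h4

lemma sum_omitIdx_le_formInner (x : D) (u : Form n n (n - 1) (E x)) :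
    ∑ k, (h.inner x (u (omitIdx k)) (u (omitIdx k))).re ≤ (h.formInner x u u).re := by
  rw [formInner, Complex.re_sum]
  calc ∑ k, (h.inner x (u (omitIdx k)) (u (omitIdx k))).re
      = ∑ S ∈ Finset.univ.map ⟨omitIdx, omitIdx_injective⟩, (h.inner x (u S) (u S)).re := by
        rw [Finset.sum_map]; rfl
    _ ≤ _ := Finset.sum_le_sum_of_subset_of_nonneg (Finset.subset_univ _)
        fun S _ _ => h.inner_self_re_nonneg x _

end HermitianMetric
end Bundle

/-! ### The estimate for the adjoint of `∂̄` -/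

section Estimate

variable {n r : ℕ} {D : TopologicalSpace.Opens (Cn n)} {E : D → Type*}
  [∀ x, AddCommGroup (E x)] [∀ x, Module ℂ (E x)] [∀ x, TopologicalSpace (E x)]
  [TopologicalSpace (TotalSpace (Fin r → ℂ) E)] [FiberBundle (Fin r → ℂ) E]
  [VectorBundle ℂ (Fin r → ℂ) E]

/-- Locally integrable coefficients may be multiplied by a cut-off function. -/
lemma integrable_smul_of_locallyIntegrableOn {V : Set D} {v : D → Fin r → ℂ}
    (hv : LocallyIntegrableOn v V (dVol D)) {φ : Cn n → ℂ} (hφ : Continuous φ)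
    (hc : HasCompactSupport φ) (hφV : tsupport φ ⊆ Subtype.val '' V) :
    Integrable (fun x : D => φ x • v x) (dVol D) := by
  have hK : IsCompact (Subtype.val ⁻¹' tsupport φ : Set D) :=
    isCompact_preimage_coe hc (hφV.trans (by rintro _ ⟨x, _, rfl⟩; exact x.2))
  have hKV : (Subtype.val ⁻¹' tsupport φ : Set D) ⊆ V := by
    intro x hx
    obtain ⟨y, hy, hyx⟩ := hφV hx
    exact Subtype.val_injective hyx ▸ hy
  have h1 : IntegrableOn (fun x : D => φ x • v x) (Subtype.val ⁻¹' tsupport φ) (dVol D) :=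
    (hv.integrableOn_compact_subset hKV hK).continuousOn_smul
      (hφ.comp continuous_subtype_val).continuousOn hK
  refine (integrableOn_iff_integrable_of_support_subset fun x hx => ?_).1 h1
  by_contra hx'
  exact hx (by simp [image_eq_zero_of_notMem_tsupport (f := φ) hx'])

/-- The duality argument: testing `∂̄u = f`, `f = (Δψ + c) χ a`, against `χ a` and estimating the
result by the arithmetic-geometric mean inequality turns the `L²` estimate for `u` into an
a priori estimate for the formal adjoint of `∂̄`. -/
lemma estimate_of_solvability [ContMDiffVectorBundle ω (Fin r → ℂ) E 𝓘(ℂ, Cn n)] (hn : 1 ≤ n)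
    (h : HermitianMetric r E) {c : ℝ} (hc : 0 ≤ c)
    (hsolve : ∀ ψ : Cn n → ℝ, IsSmoothStrictlyPsh D ψ →
      ∀ f : ∀ x, Form n n n (E x), IsTestForm r f →
        ∃ u : ∀ x, Form n n (n - 1) (E x),
          IsWeakDbar r u f ∧
          Integrable (fun x : D => (h.formInner x (u x) (u x)).re * Real.exp (-ψ x)) (dVol D) ∧
          ∫ x : D, (h.formInner x (u x) (u x)).re * Real.exp (-ψ x) ∂(dVol D) ≤
            ∫ x : D, (h.formInner x (tensorId (twistedOpInv n n ψ c x) (f x)) (f x)).re *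
              Real.exp (-ψ x) ∂(dVol D))
    (e : Trivialization (Fin r → ℂ) (π (Fin r → ℂ) E)) [MemTrivializationAtlas e]
    (p : Cn n) (a : Fin r → ℂ) {χ : Cn n → ℝ} (hχ : ContDiff ℝ ∞ χ) (hχc : HasCompactSupport χ)
    (hχU : tsupport χ ⊆ Subtype.val '' e.baseSet) {s : ℝ} (hs : 0 < s) :
    (n * s + c) * (∫ z, Real.exp (-(s * ‖z - p‖ ^ 2)) *
        (χ z ^ 2 * (frameInner (h.gram e z) a a).re)) ≤
      ∫ z, Real.exp (-(s * ‖z - p‖ ^ 2)) *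
        ∑ k, (frameInner (h.gram e z)
          (twistedCovDeriv (h.gram e) χ (fun w => s * ‖w - p‖ ^ 2) a k z)
          (twistedCovDeriv (h.gram e) χ (fun w => s * ‖w - p‖ ^ 2) a k z)).re := by
  set U : Set (Cn n) := Subtype.val '' e.baseSet with hUdef
  have hU : IsOpen U := isOpen_image_baseSet e
  have hH := h.contDiffOn_gram e
  have hdet : ∀ z ∈ U, (h.gram e z).det ≠ 0 := fun z hz => h.det_gram_ne_zero e hz
  have hherm : ∀ z ∈ U, ∀ α β, h.gram e z β α = conj (h.gram e z α β) :=
    fun z hz => h.gram_conj e hz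
  set ψ : Cn n → ℝ := fun w => s * ‖w - p‖ ^ 2 with hψdef
  have hψ : ContDiff ℝ ∞ ψ := contDiff_quadratic s p
  have hB := bochner_kodaira hU hH hdet hherm hχ hψ hχc hχU a s
    (fun k z => dbarDeriv_dDeriv_quadratic s p k z)
  set w := twistedCovDeriv (h.gram e) χ ψ a with hwdef
  set M : ℝ := n * s + c with hMdef
  have hM : 0 < M := by
    have : (0 : ℝ) < n := by exact_mod_cast hn
    positivity
  have hχcC : ContDiff ℝ ∞ (fun z => (χ z : ℂ)) := Complex.ofRealCLM.contDiff.comp hχ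
  have hmem : ∀ x : D, (x : Cn n) ∈ tsupport χ → x ∈ e.baseSet := by
    intro x hx
    obtain ⟨y, hy, hyx⟩ := hχU hx
    exact Subtype.val_injective hyx ▸ hy
  -- the test form and the solution of its `∂̄`-equation
  have hf : IsTestForm (p := n) (q := n) r (E := E)
      (fun x _ => ((M * χ x : ℝ) : ℂ) • e.symmₗ ℂ x a) := by
    have hsupp : tsupport (fun z => ((M * χ z : ℝ) : ℂ)) ⊆ tsupport χ := by
      rw [tsupport_ofReal fun z => M * χ z]
      exact tsupport_mul_subset_right
    exact isTestForm_cutoff (χ := fun z => ((M * χ z : ℝ) : ℂ)) e a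
      (Complex.ofRealCLM.contDiff.comp (contDiff_const.mul hχ))
      (hχc.of_isClosed_subset (isClosed_tsupport _) hsupp) (hsupp.trans hχU)
  obtain ⟨u, hweak, huint, hule⟩ := hsolve ψ (isSmoothStrictlyPsh_quadratic D hs p) _ hf
  obtain ⟨hloc, htest⟩ := hweak e
  -- the right-hand side of the `L²` estimate
  have hrhs : ∀ x : D, (h.formInner x (tensorId (twistedOpInv n n ψ c x)
        (fun _ : Idx n n n => ((M * χ x : ℝ) : ℂ) • e.symmₗ ℂ x a))
        (fun _ : Idx n n n => ((M * χ x : ℝ) : ℂ) • e.symmₗ ℂ x a)).re * Real.exp (-ψ x) =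
      M * (Real.exp (-ψ x) * (χ x ^ 2 * (frameInner (h.gram e x) a a).re)) := by
    intro x
    rw [tensorId_twistedOpInv c (levi_quadratic s p x)]
    by_cases hx : (x : Cn n) ∈ tsupport χ
    · rw [h.frameInner_gram e (hmem x hx), HermitianMetric.formInner, Fintype.sum_unique,
        Pi.smul_apply, ← hMdef, smul_smul]
      have h1 : ((M : ℝ) : ℂ)⁻¹ * ((M * χ x : ℝ) : ℂ) = (χ x : ℝ) := by
        push_cast
        field_simp
      rw [h1]
      simp only [map_smul, LinearMap.smul_apply, LinearMap.map_smulₛₗ, smul_eq_mul,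
        Complex.conj_ofReal, Complex.re_ofReal_mul]
      ring
    · simp [HermitianMetric.formInner, image_eq_zero_of_notMem_tsupport hx]
  simp only [hrhs] at hule
  -- the components of the test function `(·, χ a) e^{-ψ}`
  set φ := weightedDual (h.gram e) χ ψ a with hφdef
  have hφ : ∀ β, ContDiff ℝ ∞ (φ β) := fun β =>
    contDiff_mul_of_tsupport_subset hU hχcC (by rwa [tsupport_ofReal])
      (contDiffOn_exp_mul_sum hH hψ a β)
  have hφt : ∀ β, tsupport (φ β) ⊆ tsupport χ := fun β => by
    rw [← tsupport_ofReal χ]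
    exact tsupport_mul_subset_left
  have hφc : ∀ β, HasCompactSupport (φ β) := fun β =>
    hχc.of_isClosed_subset (isClosed_tsupport _) (hφt β)
  have hdφ : ∀ k β, Continuous (dbarDeriv k (φ β)) := fun k β => by
    rw [dbarDeriv_eq_wirtinger]
    exact (contDiff_wirtinger (hφ β)).continuous
  have hdφt : ∀ k β, tsupport (dbarDeriv k (φ β)) ⊆ tsupport χ := fun k β => by
    rw [dbarDeriv_eq_wirtinger]
    exact tsupport_wirtinger_subset.trans (hφt β)
  have hdφc : ∀ k β, HasCompactSupport (dbarDeriv k (φ β)) := fun k β =>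
    hχc.of_isClosed_subset (isClosed_tsupport _) (hdφt k β)
  -- the weak equation tested against them
  have hI : ∀ k β, Integrable
      (fun x : D => dbarDeriv k (φ β) x • e.linearMapAt ℂ x (u x (omitIdx k))) (dVol D) :=
    fun k β => integrable_smul_of_locallyIntegrableOn (hloc (omitIdx k)) (hdφ k β) (hdφc k β)
      ((hdφt k β).trans hχU)
  have hIβ : ∀ β, Integrable (fun x : D => ∑ k, dbarDeriv k (φ β) x • (omitSign k •
      e.linearMapAt ℂ x (u x (omitIdx k)))) (dVol D) := fun β =>
    integrable_finsetSum _ fun k _ => by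
      exact ((hI k β).smul (omitSign k)).congr
        (Filter.Eventually.of_forall fun x => smul_comm (omitSign k) (dbarDeriv k (φ β) x) _)
  have hcomp : ∀ β, ∫ x : D, φ β x * (((M * χ x : ℝ) : ℂ) * a β) ∂(dVol D) =
      -∫ x : D, ∑ k, dbarDeriv k (φ β) x *
        (omitSign k * e.linearMapAt ℂ x (u x (omitIdx k)) β) ∂(dVol D) := by
    intro β
    have h1 := htest (φ β) (hφ β) (hφc β) ((hφt β).trans hχU) (topIdx n)
    simp only [tensorId_ext_dzbar] at h1
    have h2 : ∀ x : D, φ β x • e.linearMapAt ℂ x (((M * χ x : ℝ) : ℂ) • e.symmₗ ℂ x a) =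
        (φ β x * ((M * χ x : ℝ) : ℂ)) • a := by
      intro x
      by_cases hx : (x : Cn n) ∈ tsupport χ
      · rw [map_smul, e.linearMapAt_symmₗ (hmem x hx), smul_smul]
      · simp [image_eq_zero_of_notMem_tsupport hx]
    simp only [h2] at h1
    have h3 : Integrable (fun x : D => φ β x * ((M * χ x : ℝ) : ℂ)) (dVol D) := by
      refine integrable_dVol (F := fun z => φ β z * ((M * χ z : ℝ) : ℂ)) ?_
      refine Continuous.integrable_of_hasCompactSupport ?_ (hφc β).mul_right
      exact (hφ β).continuous.mul (Complex.continuous_ofReal.comp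
        (continuous_const.mul hχ.continuous))
    have h4 := congrFun h1 β
    rw [Pi.neg_apply, eval_integral fun γ => (h3.smul_const a).eval γ,
      eval_integral fun γ => (hIβ β).eval γ] at h4
    simpa [mul_assoc] using h4
  -- summing over the frame gives `M ∫ |χ a|² e^{-ψ}` on the left
  have hsum : ∫ x : D, ∑ β, φ β x * (((M * χ x : ℝ) : ℂ) * a β) ∂(dVol D) =
      -∫ x : D, ∑ β, ∑ k, dbarDeriv k (φ β) x *
        (omitSign k * e.linearMapAt ℂ x (u x (omitIdx k)) β) ∂(dVol D) := by
    rw [integral_finsetSum, integral_finsetSum, ← Finset.sum_neg_distrib]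
    · exact Finset.sum_congr rfl fun β _ => hcomp β
    · intro β _
      simpa using (hIβ β).eval β
    · intro β _
      refine integrable_dVol (F := fun z => φ β z * (((M * χ z : ℝ) : ℂ) * a β)) ?_
      refine Continuous.integrable_of_hasCompactSupport ?_ (hφc β).mul_right
      exact (hφ β).continuous.mul ((Complex.continuous_ofReal.comp
        (continuous_const.mul hχ.continuous)).mul continuous_const)
  have hleft : ∀ x : D, ∑ β, φ β x * (((M * χ x : ℝ) : ℂ) * a β) =
      ((M * (Real.exp (-ψ x) * (χ x ^ 2 * (frameInner (h.gram e x) a a).re)) : ℝ) : ℂ) := by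
    intro x
    by_cases hx : (x : Cn n) ∈ tsupport χ
    · have hreal : ((frameInner (h.gram e x) a a).re : ℂ) = frameInner (h.gram e x) a a := by
        rw [← Complex.conj_eq_iff_re, h.frameInner_gram e (hmem x hx), ← h.conj_symm]
      push_cast
      rw [hreal, frameInner_eq_sum_mul]
      simp only [Finset.mul_sum]
      refine Finset.sum_congr rfl fun β _ => ?_
      rw [hφdef, weightedDual]
      simp only [Finset.mul_sum, Finset.sum_mul]
      refine Finset.sum_congr rfl fun γ _ => ?_
      ring
    · simp [image_eq_zero_of_notMem_tsupport hx]
  -- the pointwise estimate of the right-hand side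
  have hbound : ∀ x : D, ‖∑ β, ∑ k, dbarDeriv k (φ β) x *
        (omitSign k * e.linearMapAt ℂ x (u x (omitIdx k)) β)‖ ≤
      ((h.formInner x (u x) (u x)).re * Real.exp (-ψ x) +
        Real.exp (-ψ x) * ∑ k, (frameInner (h.gram e x) (w k x) (w k x)).re) / 2 := by
    intro x
    have hu0 : 0 ≤ (h.formInner x (u x) (u x)).re :=
      (Finset.sum_nonneg fun k _ => h.inner_self_re_nonneg x _).trans
        (h.sum_omitIdx_le_formInner x (u x))
    by_cases hx : (x : Cn n) ∈ tsupport χ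
    · have hxe := hmem x hx
      have h1 : ∑ β, ∑ k, dbarDeriv k (φ β) x *
          (omitSign k * e.linearMapAt ℂ x (u x (omitIdx k)) β) =
          ∑ k, omitSign k * (Real.exp (-ψ x) *
            h.inner x (u x (omitIdx k)) (e.symmₗ ℂ x (w k x))) := by
        rw [Finset.sum_comm]
        refine Finset.sum_congr rfl fun k _ => ?_
        have h2 : h.inner x (u x (omitIdx k)) (e.symmₗ ℂ x (w k x)) =
            frameInner (h.gram e x) (e.linearMapAt ℂ x (u x (omitIdx k))) (w k x) := by
          rw [h.frameInner_gram e hxe, e.symmₗ_linearMapAt hxe]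
        rw [h2, frameInner_eq_sum_mul, Finset.mul_sum, Finset.mul_sum]
        refine Finset.sum_congr rfl fun β _ => ?_
        rw [hφdef, dbarDeriv_weightedDual hU hH hdet hherm hχ hψ (hχU hx)]
        push_cast
        ring
      rw [h1]
      calc ‖∑ k, omitSign k * (Real.exp (-ψ x) *
            h.inner x (u x (omitIdx k)) (e.symmₗ ℂ x (w k x)))‖
          ≤ ∑ k, Real.exp (-ψ x) * (((h.inner x (u x (omitIdx k)) (u x (omitIdx k))).re +
              (h.inner x (e.symmₗ ℂ x (w k x)) (e.symmₗ ℂ x (w k x))).re) / 2) := by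
            refine (norm_sum_le _ _).trans (Finset.sum_le_sum fun k _ => ?_)
            rw [norm_mul, norm_omitSign, one_mul, norm_mul, Complex.norm_real, Real.norm_eq_abs,
              Real.abs_exp]
            exact mul_le_mul_of_nonneg_left (h.norm_inner_le x _ _) (Real.exp_pos _).le
        _ = Real.exp (-ψ x) * ((∑ k, (h.inner x (u x (omitIdx k)) (u x (omitIdx k))).re) +
              ∑ k, (frameInner (h.gram e x) (w k x) (w k x)).re) / 2 := by
            rw [← Finset.sum_add_distrib, ← Finset.mul_sum, ← Finset.sum_div, mul_div_assoc]
            simp only [h.frameInner_gram e hxe]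
        _ ≤ _ := by
            have := mul_le_mul_of_nonneg_left (h.sum_omitIdx_le_formInner x (u x))
              (Real.exp_pos (-ψ x)).le
            linarith
    · have h1 : ∀ k β, dbarDeriv k (φ β) x = 0 := fun k β =>
        image_eq_zero_of_notMem_tsupport fun hx' => hx (hdφt k β hx')
      have h2 : ∀ k, w k x = 0 := fun k => twistedCovDeriv_eq_zero hx
      simp only [h1, h2, frameInner, zero_mul, Finset.sum_const_zero, norm_zero, Pi.zero_apply,
        Complex.zero_re, mul_zero, add_zero]
      positivity
  -- conclusion on `D`, then on `ℂⁿ`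
  have hWint := integrable_dVol (D := D) hB.1
  have hmain : ∫ x : D, M * (Real.exp (-ψ x) * (χ x ^ 2 * (frameInner (h.gram e x) a a).re))
        ∂(dVol D) ≤
      ∫ x : D, Real.exp (-ψ x) * ∑ k, (frameInner (h.gram e x) (w k x) (w k x)).re ∂(dVol D) := by
    simp only [hleft] at hsum
    have h1 := norm_integral_le_of_norm_le ((huint.add hWint).div_const 2)
      (Filter.Eventually.of_forall hbound)
    simp only [Pi.add_apply] at h1
    rw [← norm_neg, ← hsum, integral_complex_ofReal, integral_div,
      integral_add huint hWint] at h1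
    have h2 := (le_abs_self _).trans (by simpa only [Complex.norm_real, Real.norm_eq_abs] using h1)
    linarith
  have hUD : ∀ z, z ∉ D → z ∉ tsupport χ := fun z hz hzt => hz (by
    obtain ⟨x, _, rfl⟩ := hχU hzt
    exact x.2)
  rw [integral_dVol (fun z => M * (Real.exp (-ψ z) * (χ z ^ 2 * (frameInner (h.gram e z) a a).re)))
      (fun z hz => by simp [image_eq_zero_of_notMem_tsupport (hUD z hz)]),
    integral_dVol (fun z => Real.exp (-ψ z) * ∑ k, (frameInner (h.gram e z) (w k z) (w k z)).re)
      (fun z hz => by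
        have h2 : ∀ k, w k z = 0 := fun k => twistedCovDeriv_eq_zero (hUD z hz)
        simp [h2, frameInner]), integral_const_mul] at hmain
  exact le_of_mul_le_mul_left (by simpa only [smul_eq_mul] using hmain) (by positivity : (0:ℝ) < 2 ^ n)

namespace HermitianMetric

variable (h : HermitianMetric r E)

lemma trCurv_eq_sum (x : D) (a : E x) :
    h.trCurv x a = ∑ j, (h.inner x (h.chernCurvature x j j a) a).re := by
  simp [trCurv, Matrix.trace, curvForm]

lemma curvEval_single (x : D) (j : Fin n) (a : E x) :
    h.curvEval x (EuclideanSpace.single j 1) a = (h.inner x (h.chernCurvature x j j a) a).re := by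
  rw [curvEval, Finset.sum_eq_single j, Finset.sum_eq_single j]
  · simp [curvForm]
  · intro k _ hk
    simp [hk]
  · simp
  · intro k _ hk
    simp [hk]
  · simp

end HermitianMetric

end Estimate
end RCPos
theorem theorem1p2 {n r : ℕ} (hn : 1 ≤ n) (D : TopologicalSpace.Opens (RCPos.Cn n))
    (hconn : IsConnected (D : Set (RCPos.Cn n)))
    (hbdd : Bornology.IsBounded (D : Set (RCPos.Cn n)))
    (hpsc : RCPos.IsPseudoconvex D)
    (E : D → Type*) [∀ x, AddCommGroup (E x)] [∀ x, Module ℂ (E x)] [∀ x, TopologicalSpace (E x)]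
    [TopologicalSpace (TotalSpace (Fin r → ℂ) E)] [FiberBundle (Fin r → ℂ) E]
    [VectorBundle ℂ (Fin r → ℂ) E]
    [ContMDiffVectorBundle ω (Fin r → ℂ) E 𝓘(ℂ, RCPos.Cn n)]
    (h : RCPos.HermitianMetric r E) (c : ℝ) (hc : 0 ≤ c)
    (hsolve : ∀ ψ : RCPos.Cn n → ℝ, RCPos.IsSmoothStrictlyPsh D ψ →
      ∀ f : ∀ x, RCPos.Form n n n (E x), RCPos.IsTestForm r f →
        ∃ u : ∀ x, RCPos.Form n n (n - 1) (E x),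
          RCPos.IsWeakDbar r u f ∧
          Integrable (fun x : D => (h.formInner x (u x) (u x)).re * Real.exp (-ψ x))
            (RCPos.dVol D) ∧
          ∫ x : D, (h.formInner x (u x) (u x)).re * Real.exp (-ψ x) ∂(RCPos.dVol D) ≤
            ∫ x : D, (h.formInner x
              (RCPos.tensorId (RCPos.twistedOpInv n n ψ c x) (f x)) (f x)).re * Real.exp (-ψ x)
                ∂(RCPos.dVol D)) :
    (∀ (x : D) (a : E x), c * (h.inner x a a).re ≤ h.trCurv x a) ∧
      (0 < c → h.IsRCPositive) ∧ (c = 0 → h.IsRCSemipositive) := by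
  have main : ∀ (x : D) (a : E x), c * (h.inner x a a).re ≤ h.trCurv x a := by
    intro x a
    let e := trivializationAt (Fin r → ℂ) E x
    have hx : x ∈ e.baseSet := FiberBundle.mem_baseSet_trivializationAt' x
    have hsym : e.symmₗ ℂ x (e.linearMapAt ℂ x a) = a := e.symmₗ_linearMapAt hx a
    have key := RCPos.le_trace_curvMatrix_of_estimate (RCPos.isOpen_image_baseSet e)
      (h.contDiffOn_gram e) (fun z hz => h.det_gram_ne_zero e hz) (fun z hz => h.gram_conj e hz)
      (Set.mem_image_of_mem Subtype.val hx) (e.linearMapAt ℂ x a) c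
      (fun χ hχ hχc hχU s hs =>
        RCPos.estimate_of_solvability hn h hc hsolve e x _ hχ hχc hχU hs)
    simp only [h.frameInner_gram e hx, hsym] at key
    rw [h.trCurv_eq_sum]
    exact key
  refine ⟨main, fun hc0 x a ha => ?_, fun hc0 x a ha => ?_⟩
  · have h1 : 0 < ∑ j, (h.inner x (h.chernCurvature x j j a) a).re := by
      rw [← h.trCurv_eq_sum]
      exact (mul_pos hc0 (h.pos x a ha)).trans_le (main x a)
    obtain ⟨j, -, hj⟩ := Finset.exists_lt_of_sum_lt (s := Finset.univ) (f := fun _ => (0 : ℝ))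
      (by simpa using h1)
    exact ⟨EuclideanSpace.single j 1, by rwa [h.curvEval_single]⟩
  · have h1 : 0 ≤ ∑ j, (h.inner x (h.chernCurvature x j j a) a).re := by
      rw [← h.trCurv_eq_sum]
      simpa [hc0] using main x a
    have : Nonempty (Fin n) := ⟨⟨0, hn⟩⟩
    obtain ⟨j, -, hj⟩ := Finset.exists_le_of_sum_le (s := Finset.univ) (f := fun _ => (0 : ℝ))
      Finset.univ_nonempty (by simpa using h1)
    exact ⟨EuclideanSpace.single j 1, by simp, by rwa [h.curvEval_single]⟩
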